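/- Consider the initial value problem for the Majda-Biello system with $\alpha = 4$ and $\beta = 0$, \[ u_t + u_{xxx} = - v v_x, \qquad v_t + 4 v_{xxx} = -(uv)_x, \qquad (u,v)|_{t=0} = (u_0,v_0) \in H^s(\mathbb{R}) \times H^s(\mathbb{R}), \qquad x \in \mathbb{R}. \] For every real $s < \frac34$ this problem fails to be $C^2$ locally well-posed in $H^s(\mathbb{R})\times H^s(\mathbb{R})$, both for real-valued and for complex-valued functions. Here the problem is called $C^2$ locally well-posed in $H^s(\mathbb{R})\times H^s(\mathbb{R})$ if every $w_0 \in H^s(\mathbb{R})\times H^s(\mathbb{R})$ has an open neighbourhood $U$ and a time $T>0$ such that for each $(u_0,v_0) \in U$ there is exactly one solution $(u,v) \in C([0,T]; H^s(\mathbb{R})\times H^s(\mathbb{R}))$ with these initial data, and the map $(u_0,v_0) \mapsto (u,v)$ from $U$ to $C([0,T]; H^s(\mathbb{R})\times H^s(\mathbb{R}))$ is twice continuously (Fréchet) differentiable over $\mathbb{R}$; solutions in $C([0,T]; H^s(\mathbb{R})\times H^s(\mathbb{R}))$ are the limits, in this space, of smooth solutions on $[0,T]\times\mathbb{R}$ that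 belong to $C([0,T]; H^\sigma(\mathbb{R})\times H^\sigma(\mathbb{R}))$ for every real $\sigma$. -/

import Mathlib

open MeasureTheory Set Topology
open scoped SchwartzMap ContDiff

noncomputable section

namespace MajdaBiello

/-- A tempered distribution is `𝔽`-valued if it maps real-valued test functions into `𝔽`.
The only subalgebras of `ℂ` over `ℝ` are `⊥` (the real numbers) and `⊤` (all of `ℂ`), so this
covers real-valued distributions (`𝔽 = ⊥`) and arbitrary complex ones (`𝔽 = ⊤`). -/
def IsValuedIn (𝔽 : Subalgebra ℝ ℂ) (f : 𝓢'(ℝ, ℂ)) : Prop :=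
  ∀ g : 𝓢(ℝ, ℂ), (∀ x, (g x).im = 0) → f g ∈ 𝔽

/-- The `𝔽`-valued tempered distributions `f` on the line with `(1 + |ξ|²)^(s/2) 𝓕 f ∈ L²`. -/
def sobolevSubmodule (𝔽 : Subalgebra ℝ ℂ) (s : ℝ) : Submodule ℝ 𝓢'(ℝ, ℂ) where
  carrier := {f | TemperedDistribution.MemSobolev s 2 f ∧ IsValuedIn 𝔽 f}
  zero_mem' := ⟨TemperedDistribution.memSobolev_fun_zero ℝ ℂ s 2, fun _ _ => 𝔽.zero_mem⟩
  add_mem' := fun hf hg => ⟨hf.1.add hg.1, fun g h => 𝔽.add_mem (hf.2 g h) (hg.2 g h)⟩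
  smul_mem' := fun c f hf =>
    ⟨by simpa using hf.1.smul (c : ℂ), fun g h => 𝔽.smul_mem (hf.2 g h) c⟩

/-- The Sobolev space `H^s(ℝ)` of `𝔽`-valued tempered distributions (`𝔽 = ℝ` or `ℂ`). -/
def SobolevSpace (𝔽 : Subalgebra ℝ ℂ) (s : ℝ) : Type := sobolevSubmodule 𝔽 s

namespace SobolevSpace

variable {𝔽 : Subalgebra ℝ ℂ} {s : ℝ}

instance : AddCommGroup (SobolevSpace 𝔽 s) := inferInstanceAs (AddCommGroup (sobolevSubmodule 𝔽 s))

instance : Module ℝ (SobolevSpace 𝔽 s) := inferInstanceAs (Module ℝ (sobolevSubmodule 𝔽 s))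

/-- The underlying tempered distribution. -/
def toDistribution (f : SobolevSpace 𝔽 s) : 𝓢'(ℝ, ℂ) := f.1

theorem exists_bessel (f : SobolevSpace 𝔽 s) : ∃ g : Lp ℂ 2 (volume : Measure ℝ),
    TemperedDistribution.besselPotential ℝ ℂ s f.toDistribution
      = Lp.toTemperedDistributionCLM ℂ volume 2 g := f.2.1

theorem toTempered_injective :
    Function.Injective (Lp.toTemperedDistributionCLM ℂ (volume : Measure ℝ) 2) :=
  LinearMap.ker_eq_bot.mp
    (Lp.ker_toTemperedDistributionCLM_eq_bot (F := ℂ) (μ := (volume : Measure ℝ)) (p := 2))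

/-- The map `f ↦ 𝓕⁻¹ (1 + |ξ|²)^(s/2) 𝓕 f` from `H^s` to `L²`. -/
def bessel : SobolevSpace 𝔽 s →ₗ[ℝ] Lp ℂ 2 (volume : Measure ℝ) where
  toFun f := (exists_bessel f).choose
  map_add' f g := by
    apply toTempered_injective
    rw [map_add, ← (exists_bessel f).choose_spec, ← (exists_bessel g).choose_spec,
      ← (exists_bessel (f + g)).choose_spec, ← map_add]
    rfl
  map_smul' c f := by
    apply toTempered_injective
    rw [RingHom.id_apply, ContinuousLinearMap.map_smul_of_tower,
      ← (exists_bessel f).choose_spec, ← (exists_bessel (c • f)).choose_spec,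
      ← ContinuousLinearMap.map_smul_of_tower]
    rfl

theorem bessel_spec (f : SobolevSpace 𝔽 s) :
    TemperedDistribution.besselPotential ℝ ℂ s f.toDistribution
      = Lp.toTemperedDistributionCLM ℂ volume 2 (bessel f) := (exists_bessel f).choose_spec

theorem bessel_injective : Function.Injective (bessel : SobolevSpace 𝔽 s →ₗ[ℝ] _) := by
  intro f g h
  have h1 : TemperedDistribution.besselPotential ℝ ℂ s f.toDistribution
      = TemperedDistribution.besselPotential ℝ ℂ s g.toDistribution := by
    rw [bessel_spec, bessel_spec, h]
  have h2 := congrArg (TemperedDistribution.besselPotential ℝ ℂ (-s)) h1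
  simp only [TemperedDistribution.besselPotential_besselPotential_apply, add_neg_cancel,
    TemperedDistribution.besselPotential_zero, ContinuousLinearMap.id_apply] at h2
  exact Subtype.ext h2

/-- The norm of `H^s` is `‖f‖ = ‖(1 + |ξ|²)^(s/2) 𝓕 f‖_{L²} = ‖𝓕⁻¹ (1 + |ξ|²)^(s/2) 𝓕 f‖_{L²}`. -/
instance : NormedAddCommGroup (SobolevSpace 𝔽 s) :=
  NormedAddCommGroup.induced _ _ (bessel : SobolevSpace 𝔽 s →ₗ[ℝ] _) bessel_injective

instance : NormedSpace ℝ (SobolevSpace 𝔽 s) :=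
  NormedSpace.induced ℝ _ _ (bessel : SobolevSpace 𝔽 s →ₗ[ℝ] _)

/-- The element `f` of `H^s` is given by the square integrable function `g`. -/
def IsGivenBy (f : SobolevSpace 𝔽 s) (g : ℝ → ℂ) : Prop :=
  ∃ h : MemLp g 2 volume, f.toDistribution = Lp.toTemperedDistributionCLM ℂ volume 2 (h.toLp g)

end SobolevSpace

/-- The data space `H^s(ℝ) × H^s(ℝ)`. -/
abbrev DataSpace (𝔽 : Subalgebra ℝ ℂ) (s : ℝ) : Type := SobolevSpace 𝔽 s × SobolevSpace 𝔽 s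

/-- The space `C([0,T]; H^s(ℝ) × H^s(ℝ))`, with the supremum norm. -/
abbrev PathSpace (𝔽 : Subalgebra ℝ ℂ) (s T : ℝ) : Type := C(Icc (0 : ℝ) T, DataSpace 𝔽 s)

/-- The path `w` in `H^s × H^s` is given by the pair of functions `u t x`, `v t x`. -/
def PathIsGivenBy {𝔽 : Subalgebra ℝ ℂ} {s T : ℝ} (w : PathSpace 𝔽 s T) (u v : ℝ → ℝ → ℂ) : Prop :=
  ∀ t : Icc (0 : ℝ) T, (w t).1.IsGivenBy (u t) ∧ (w t).2.IsGivenBy (v t)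

/-- `(u, v)` is a smooth solution on `[0,T] × ℝ`, continuous in time with values in every
Sobolev space, of
`u_t + u_xxx = - v v_x`, `v_t + α v_xxx + β v_x = - (u v)_x`. -/
structure IsSmoothSolution (𝔽 : Subalgebra ℝ ℂ) (α β T : ℝ) (u v : ℝ → ℝ → ℂ) : Prop where
  smooth_u : ∀ t ∈ Icc 0 T, ContDiff ℝ ∞ (u t)
  smooth_v : ∀ t ∈ Icc 0 T, ContDiff ℝ ∞ (v t)
  continuous_sobolev : ∀ σ : ℝ, ∃ w : PathSpace 𝔽 σ T, PathIsGivenBy w u v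
  eq_u : ∀ t ∈ Icc 0 T, ∀ x, HasDerivWithinAt (fun τ => u τ x)
    (-iteratedDeriv 3 (u t) x - v t x * deriv (v t) x) (Icc 0 T) t
  eq_v : ∀ t ∈ Icc 0 T, ∀ x, HasDerivWithinAt (fun τ => v τ x)
    (-(α * iteratedDeriv 3 (v t) x) - β * deriv (v t) x - deriv (fun y => u t y * v t y) x)
    (Icc 0 T) t

/-- Solutions in `C([0,T]; H^s × H^s)`: the limits, in this space, of smooth solutions. This has
a meaning for every real `s`, also where the products in the equations cannot be formed directly;
for `s ≥ 0` such a limit satisfies the equations in the sense of distributions. -/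
def IsSolution {𝔽 : Subalgebra ℝ ℂ} {s T : ℝ} (α β : ℝ) (w : PathSpace 𝔽 s T) : Prop :=
  w ∈ closure {z : PathSpace 𝔽 s T | ∃ u v, IsSmoothSolution 𝔽 α β T u v ∧ PathIsGivenBy z u v}

/-- Local well-posedness in `H^s × H^s` with a `C^k` solution map: near every initial datum there
are a common time of existence `T > 0` and, for every datum, exactly one solution in
`C([0,T]; H^s × H^s)`, and the map from the data to the solutions is `C^k`. -/
def IsLocallyWellPosed (k : WithTop ℕ∞) (𝔽 : Subalgebra ℝ ℂ) (α β s : ℝ) : Prop :=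
  ∀ w₀ : DataSpace 𝔽 s, ∃ (T : ℝ) (hT : 0 < T) (U : Set (DataSpace 𝔽 s))
    (Φ : DataSpace 𝔽 s → PathSpace 𝔽 s T), IsOpen U ∧ w₀ ∈ U ∧
    (∀ f ∈ U, IsSolution α β (Φ f) ∧ Φ f ⟨0, left_mem_Icc.mpr hT.le⟩ = f ∧
      ∀ w : PathSpace 𝔽 s T, IsSolution α β w → w ⟨0, left_mem_Icc.mpr hT.le⟩ = f → w = Φ f) ∧
    ContDiffOn ℝ k Φ U

end MajdaBiello

end

/-!
If the flow map is twice differentiable at the origin, then the second Picard iterate of the data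
`(0, g)`, whose first component is half the response of `u_t + u_xxx = F` to the source
`F = -(v²)_x` of the free wave `v` of `g`, is bounded by a multiple of `‖g‖²` in `H^s`. On the
frequency side, two waves `v` of frequencies `η` and `ξ - η` drive `u` at frequency `ξ` with phase
`4η³ + 4(ξ - η)³ - ξ³ = 3ξ(ξ - 2η)²`, which vanishes to second order at `ξ = 2η`. Hence if `ĝ` is
concentrated within distance `δ ~ N^(-1/2)` of `±N`, the interaction is coherent for times of order
one, and the second iterate has size at least a multiple of `Nδ` at the frequencies within `δ` of
`2N`. Comparing the norms, `N^s δ^(1/2) Nδ ≲ N^(2s) δ`, which fails for large `N` if `s < 3/4`.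

To see the second iterate through the solution map one needs smooth solutions with data `ε(0, g)`.
They are obtained, on any given time interval and for small `ε`, by a Cauchy-Kovalevskaya argument
in spaces of functions analytic in a strip whose width decreases in time.
-/

noncomputable section

namespace MajdaBiello

open Asymptotics Filter
open scoped BoundedContinuousFunction ComplexConjugate Convolution FourierTransform

section QuadraticExpansion

variable {E F : Type*} [NormedAddCommGroup E] [NormedSpace ℝ E] [NormedAddCommGroup F]
  [NormedSpace ℝ F]

theorem isBigO_bilinear (B : E →L[ℝ] E →L[ℝ] E) {α : Type*} {l : Filter α} {f g : α → E}
    {φ : α → ℝ} {m n : ℕ} (hf : f =O[l] fun x => φ x ^ m) (hg : g =O[l] fun x => φ x ^ n) :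
    (fun x => B (f x) (g x)) =O[l] fun x => φ x ^ (m + n) := by
  simpa only [pow_add] using
    (IsBigO.of_norm_le fun x => by simpa using B.le_opNorm₂ (f x) (g x)).trans
      (((hf.norm_left.mul hg.norm_left).const_mul_left ‖B‖).congr_left fun x => by ring)

theorem exists_bilinear_prod (c : ℝ) (D D' : E →L[ℝ] E →L[ℝ] E) :
    ∃ P : E × E →L[ℝ] E × E →L[ℝ] E × E, ∀ w z, P w z = (c • D w.2 z.2, D' w.1 z.2) := by
  let p₁ := ContinuousLinearMap.fst ℝ E E
  let p₂ := ContinuousLinearMap.snd ℝ E E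
  refine ⟨ContinuousLinearMap.compL ℝ (E × E) E (E × E) (.inl ℝ E E) ∘L
      (c • D.bilinearComp p₂ p₂)
    + ContinuousLinearMap.compL ℝ (E × E) E (E × E) (.inr ℝ E E) ∘L D'.bilinearComp p₁ p₂,
    fun w z => ?_⟩
  simp [p₁, p₂]

theorem exists_quadratic_fixedPoint [CompleteSpace E] (B : E →L[ℝ] E →L[ℝ] E) :
    ∃ W : E → E, (∀ᶠ l in 𝓝 0, W l = l + B (W l) (W l)) ∧
      (fun l => W l - l - B l l) =O[𝓝 0] fun l => ‖l‖ ^ 3 := by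
  have hG : HasStrictFDerivAt (fun w => w - B w w) (ContinuousLinearEquiv.refl ℝ E : E →L[ℝ] E)
      0 := by
    convert! (hasStrictFDerivAt_id (𝕜 := ℝ) (0 : E)).sub
      (B.hasStrictFDerivAt_of_bilinear (hasStrictFDerivAt_id 0) (hasStrictFDerivAt_id 0)) using 1
    ext
    simp
  set W := hG.localInverse
  have hfix : ∀ᶠ l in 𝓝 0, W l - l = B (W l) (W l) := by
    have hinv := hG.eventually_right_inverse
    simp only [map_zero, sub_zero] at hinv
    exact hinv.mono fun l hl => sub_eq_of_eq_add (sub_eq_iff_eq_add'.mp hl)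
  have hW₀ : W 0 = 0 := by simpa using hG.localInverse_apply_image
  have hlin : W =O[𝓝 0] fun l => ‖l‖ ^ 1 := by
    simpa [W, hW₀] using hG.to_localInverse.hasFDerivAt.isBigO_sub.norm_right
  have hquad : (fun l => W l - l) =O[𝓝 0] fun l => ‖l‖ ^ 2 :=
    (isBigO_bilinear B hlin hlin).congr' (hfix.mono fun l hl => hl.symm) .rfl
  have hid : (fun l : E => l) =O[𝓝 0] fun l => ‖l‖ ^ 1 := by
    simpa using (isBigO_refl (fun l : E => l) (𝓝 0)).norm_right
  refine ⟨W, hfix.mono fun l hl => sub_eq_iff_eq_add'.mp hl,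
    ((isBigO_bilinear B (m := 2) (n := 1) hquad hlin).add
      (isBigO_bilinear B (m := 1) (n := 2) hid hquad)).congr' ?_ .rfl⟩
  filter_upwards [hfix] with l hl
  calc B (W l - l) (W l) + B l (W l - l) = B (W l) (W l) - B l l := by
        simp only [map_sub, sub_apply]; abel
    _ = W l - l - B l l := by rw [hl]

theorem isBigO_taylor_two {Φ : E → F} {x : E} (hΦ : ContDiffAt ℝ 2 Φ x) :
    (fun h => Φ (x + h) - Φ x - fderiv ℝ Φ x h) =O[𝓝 0] fun h => ‖h‖ ^ 2 := by
  obtain ⟨K, s, hs, hK⟩ := (hΦ.fderiv_right (m := 1) (by norm_num)).exists_lipschitzOnWith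
  have hdiff : ∀ᶠ y in 𝓝 x, DifferentiableAt ℝ Φ y :=
    (hΦ.eventually (by simp)).mono fun y hy => hy.differentiableAt (by simp)
  obtain ⟨δ, hδ, hball⟩ := Metric.mem_nhds_iff.mp (inter_mem hs hdiff)
  refine IsBigO.of_bound K ?_
  filter_upwards [Metric.ball_mem_nhds 0 hδ] with h hh
  have hsub : Metric.closedBall x ‖h‖ ⊆ Metric.ball x δ :=
    Metric.closedBall_subset_ball (mem_ball_zero_iff.mp hh)
  have hmvt := (convex_closedBall x ‖h‖).norm_image_sub_le_of_norm_fderiv_le'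
    (fun y hy => (hball (hsub hy)).2) (φ := fderiv ℝ Φ x) (C := K * ‖h‖) (x := x) (y := x + h)
    (fun y hy => ?_) (Metric.mem_closedBall_self (norm_nonneg h)) (by simp)
  · simpa [sq, mul_assoc] using hmvt
  · refine (hK.norm_sub_le (hball (hsub hy)).1 (hball (Metric.mem_ball_self hδ)).1).trans ?_
    gcongr
    exact mem_closedBall_iff_norm.mp hy

theorem exists_norm_secondOrder_le {Φ : E → F} {x : E} (hΦ : ContDiffAt ℝ 2 Φ x) :
    ∃ C, ∀ (h : E) (a p q : F),
      (fun ε : ℝ => Φ (x + ε • h) - (a + ε • p + ε ^ 2 • q)) =o[𝓝 0] (fun ε => ε ^ 2) →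
        ‖q‖ ≤ C * ‖h‖ ^ 2 := by
  obtain ⟨C, hC⟩ := (isBigO_taylor_two hΦ).bound
  refine ⟨C, fun h a p q hq => le_of_forall_pos_le_add fun η hη => ?_⟩
  set P : ℝ → F := fun ε => a + ε • p + ε ^ 2 • q - Φ x - ε • fderiv ℝ Φ x h
  have hP : ∀ᶠ ε in 𝓝 0, ‖P ε‖ ≤ (C * ‖h‖ ^ 2 + η) * ε ^ 2 := by
    have hlim : Tendsto (fun ε : ℝ => ε • h) (𝓝 0) (𝓝 0) := by
      exact (by fun_prop : Continuous fun ε : ℝ => ε • h).tendsto' 0 0 (zero_smul ℝ h)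
    filter_upwards [hlim.eventually hC, hq.def hη] with ε htaylor hexp
    simp only [map_smul, norm_pow, norm_norm] at htaylor
    rw [norm_smul, mul_pow, Real.norm_eq_abs, sq_abs] at htaylor
    rw [Real.norm_of_nonneg (sq_nonneg ε)] at hexp
    have hsplit : P ε = (Φ (x + ε • h) - Φ x - ε • fderiv ℝ Φ x h)
        - (Φ (x + ε • h) - (a + ε • p + ε ^ 2 • q)) := by simp only [P]; abel
    rw [hsplit]
    linarith [norm_sub_le (Φ (x + ε • h) - Φ x - ε • fderiv ℝ Φ x h)
      (Φ (x + ε • h) - (a + ε • p + ε ^ 2 • q))]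
  have hP₀ : P 0 = 0 := by simpa using hP.self_of_nhds
  have hneg : Tendsto (Neg.neg : ℝ → ℝ) (𝓝 0) (𝓝 0) := continuous_neg.tendsto' 0 0 neg_zero
  obtain ⟨ε, ⟨hε, hε'⟩, hne⟩ := (((hP.and (hneg.eventually hP)).filter_mono
    nhdsWithin_le_nhds).and (eventually_mem_nhdsWithin (s := {(0 : ℝ)}ᶜ))).exists
  have hsymm : (2 * ε ^ 2) • q = P ε + P (-ε) := calc
    (2 * ε ^ 2) • q = P ε + P (-ε) - (2 : ℝ) • P 0 := by simp only [P]; module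
    _ = P ε + P (-ε) := by rw [hP₀, smul_zero, sub_zero]
  have hpos : 0 < ε ^ 2 := by have : ε ≠ 0 := hne; positivity
  have hbound : 2 * ε ^ 2 * ‖q‖ ≤ 2 * ε ^ 2 * (C * ‖h‖ ^ 2 + η) := calc
    2 * ε ^ 2 * ‖q‖ = ‖P ε + P (-ε)‖ := by
        rw [← hsymm, norm_smul, Real.norm_of_nonneg (by positivity)]
    _ ≤ (C * ‖h‖ ^ 2 + η) * ε ^ 2 + (C * ‖h‖ ^ 2 + η) * ε ^ 2 := by
        simpa using norm_add_le_of_le hε hε'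
    _ = 2 * ε ^ 2 * (C * ‖h‖ ^ 2 + η) := by ring
  exact le_of_mul_le_mul_left hbound (by positivity)

end QuadraticExpansion

section Sobolev

theorem isBigO_rpow_mul_exp (σ : ℝ) :
    (fun ξ : ℝ => (1 + ξ ^ 2) ^ σ * Real.exp (-|ξ|)) =O[⊤] fun ξ => (1 + ξ ^ 2)⁻¹ := by
  obtain ⟨m, hm⟩ := exists_nat_ge σ
  refine IsBigO.of_bound (Real.exp 1 * (2 * (m + 1)).factorial) (Eventually.of_forall fun ξ => ?_)
  have hbase : 1 ≤ 1 + ξ ^ 2 := by nlinarith [sq_nonneg ξ]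
  have hsq : 1 + ξ ^ 2 ≤ (1 + |ξ|) ^ 2 := by nlinarith [sq_abs ξ, abs_nonneg ξ]
  have hexp := Real.pow_div_factorial_le_exp (1 + |ξ|) (by positivity) (2 * (m + 1))
  rw [div_le_iff₀ (by positivity)] at hexp
  rw [Real.norm_of_nonneg (by positivity), Real.norm_of_nonneg (by positivity),
    ← div_eq_mul_inv, le_div_iff₀ (by positivity)]
  calc (1 + ξ ^ 2) ^ σ * Real.exp (-|ξ|) * (1 + ξ ^ 2)
      ≤ (1 + ξ ^ 2) ^ m * Real.exp (-|ξ|) * (1 + ξ ^ 2) := by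
        gcongr
        exact (Real.rpow_le_rpow_of_exponent_le hbase hm).trans_eq (Real.rpow_natCast _ m)
    _ = (1 + ξ ^ 2) ^ (m + 1) * Real.exp (-|ξ|) := by ring
    _ ≤ ((1 + |ξ|) ^ 2) ^ (m + 1) * Real.exp (-|ξ|) := by gcongr
    _ ≤ Real.exp (1 + |ξ|) * (2 * (m + 1)).factorial * Real.exp (-|ξ|) := by
        rw [← pow_mul]; gcongr
    _ = Real.exp 1 * (2 * (m + 1)).factorial := by
        rw [mul_right_comm, ← Real.exp_add, add_neg_cancel_right]

theorem continuous_one_add_sq_rpow (σ : ℝ) : Continuous fun ξ : ℝ => (1 + ξ ^ 2) ^ σ :=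
  Continuous.rpow_const (by fun_prop) fun ξ => Or.inl (by positivity)

theorem integrable_rpow_mul_exp (σ : ℝ) :
    Integrable fun ξ : ℝ => (1 + ξ ^ 2) ^ σ * Real.exp (-|ξ|) :=
  (isBigO_rpow_mul_exp σ).integrable
    ((continuous_one_add_sq_rpow σ).mul (by fun_prop)).aestronglyMeasurable
    integrable_inv_one_add_sq

theorem integrable_abs_pow_mul_exp (n : ℕ) :
    Integrable fun ξ : ℝ => |ξ| ^ n * Real.exp (-|ξ|) := by
  refine (integrable_rpow_mul_exp n).mono' (by fun_prop) (Eventually.of_forall fun ξ => ?_)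
  have habs : |ξ| ≤ 1 + ξ ^ 2 := by nlinarith [sq_abs ξ, sq_nonneg (|ξ| - 1)]
  rw [Real.norm_of_nonneg (by positivity), Real.rpow_natCast]
  gcongr

/-- The exponentially decaying continuous functions: they are used as Fourier transforms, and the
rate `1` makes the inverse transforms smooth with all derivatives square integrable. -/
structure ExpDecay (g : ℝ → ℂ) : Prop where
  continuous : Continuous g
  isBigO : g =O[⊤] fun ξ => Real.exp (-|ξ|)

/-- Multiplication by `(1 + ξ²)^(σ/2)`, the symbol of the Bessel potential of order `σ`. -/
def weighted (σ : ℝ) (g : ℝ → ℂ) (ξ : ℝ) : ℂ := (((1 + ‖ξ‖ ^ 2) ^ (σ / 2) : ℝ) : ℂ) * g ξ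

theorem norm_weighted_sq (σ : ℝ) (g : ℝ → ℂ) (ξ : ℝ) :
    ‖weighted σ g ξ‖ ^ 2 = (1 + ξ ^ 2) ^ σ * ‖g ξ‖ ^ 2 := by
  rw [weighted, norm_mul, mul_pow, Complex.norm_real, Real.norm_of_nonneg (by positivity),
    ← Real.rpow_natCast, ← Real.rpow_mul (by positivity), Real.norm_eq_abs, sq_abs]
  norm_num

namespace ExpDecay

variable {g h : ℝ → ℂ}

theorem of_norm_le {M : ℝ} (hc : Continuous g) (hM : ∀ ξ, ‖g ξ‖ ≤ M * Real.exp (-|ξ|)) :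
    ExpDecay g :=
  ⟨hc, IsBigO.of_bound M <| Eventually.of_forall fun ξ => by simpa using hM ξ⟩

theorem exists_norm_le (hg : ExpDecay g) : ∃ M, ∀ ξ, ‖g ξ‖ ≤ M * Real.exp (-|ξ|) := by
  simpa [isBigO_top] using hg.isBigO

theorem comp_neg (hg : ExpDecay g) : ExpDecay fun ξ => g (-ξ) := by
  obtain ⟨M, hM⟩ := hg.exists_norm_le
  exact of_norm_le (hg.continuous.comp continuous_neg) fun ξ => by simpa using hM (-ξ)

theorem integrable_pow_smul (hg : ExpDecay g) (n : ℕ) : Integrable fun ξ : ℝ => ξ ^ n • g ξ := by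
  have hpow : (fun ξ : ℝ => ξ ^ n) =O[⊤] fun ξ => |ξ| ^ n := IsBigO.of_norm_le fun ξ => by simp
  exact (hpow.smul hg.isBigO).integrable
    ((continuous_pow n).smul hg.continuous).aestronglyMeasurable (integrable_abs_pow_mul_exp n)

theorem integrable (hg : ExpDecay g) : Integrable g := by simpa using hg.integrable_pow_smul 0

theorem memLp_weighted (hg : ExpDecay g) (σ : ℝ) : MemLp (weighted σ g) 2 := by
  have hcont : Continuous (weighted σ g) := by
    have := continuous_one_add_sq_rpow (σ / 2)
    have := hg.continuous
    unfold weighted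
    simp only [Real.norm_eq_abs, sq_abs]
    fun_prop
  rw [memLp_two_iff_integrable_sq_norm hcont.aestronglyMeasurable]
  have hexp : (fun ξ : ℝ => Real.exp (-|ξ|) ^ 2) =O[⊤] fun ξ => Real.exp (-|ξ|) :=
    IsBigO.of_norm_le fun ξ => by
      rw [Real.norm_of_nonneg (by positivity)]
      exact pow_le_of_le_one (Real.exp_pos _).le (by simp) two_ne_zero
  refine (((isBigO_refl (fun ξ : ℝ => (1 + ξ ^ 2) ^ σ) ⊤).mul
    ((hg.isBigO.norm_left.pow 2).trans hexp)).congr_left fun ξ =>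
      (norm_weighted_sq σ g ξ).symm).integrable
    (hcont.norm.pow 2).aestronglyMeasurable (integrable_rpow_mul_exp σ)

theorem memLp (hg : ExpDecay g) : MemLp g 2 := by
  have hweighted : weighted 0 g = g := by ext ξ; simp [weighted]
  exact hweighted ▸ hg.memLp_weighted 0

end ExpDecay

section FourierInversion

variable {g : ℝ → ℂ}

theorem continuous_fourierInv_of_integrable (hg : Integrable g) : Continuous (𝓕⁻ g) :=
  VectorFourier.fourierIntegral_continuous Real.continuous_fourierChar
    (continuous_inner (𝕜 := ℝ) (E := ℝ)).neg hg

theorem integral_mul_fourierInv (φ : 𝓢(ℝ, ℂ)) (hg : Integrable g) :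
    ∫ x, φ x • 𝓕⁻ g x = ∫ ξ, 𝓕⁻ φ ξ • g ξ := by
  have hflip : (-innerₗ ℝ : ℝ →ₗ[ℝ] ℝ →ₗ[ℝ] ℝ).flip = -innerₗ ℝ := by ext; simp
  have hself := VectorFourier.integral_fourierIntegral_smul_eq_flip (e := Real.fourierChar)
    (μ := volume) (ν := volume) (L := -innerₗ ℝ) (f := (φ : ℝ → ℂ)) (g := g)
    Real.continuous_fourierChar (continuous_inner (𝕜 := ℝ) (E := ℝ)).neg φ.integrable hg
  rw [hflip] at hself
  rw [SchwartzMap.fourierInv_coe]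
  exact hself.symm

theorem fourierInv_toLp_ae (hg : Integrable g) (hg₂ : MemLp g 2) :
    (𝓕⁻ (hg₂.toLp g) : Lp ℂ 2 (volume : Measure ℝ)) =ᵐ[volume] 𝓕⁻ g := by
  refine ae_eq_of_integral_contDiff_smul_eq ((Lp.memLp _).locallyIntegrable (by norm_num))
    (continuous_fourierInv_of_integrable hg).locallyIntegrable fun φ hφ hsupp => ?_
  have hsupp' : HasCompactSupport (Complex.ofRealCLM ∘ φ) := hsupp.comp_left rfl
  have hφ' : ContDiff ℝ ∞ (Complex.ofRealCLM ∘ φ) := by fun_prop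
  set ψ := hsupp'.toSchwartzMap hφ'
  have hdual : Lp.toTemperedDistribution (𝓕⁻ (hg₂.toLp g) : Lp ℂ 2 (volume : Measure ℝ)) ψ
      = ∫ x, ψ x • 𝓕⁻ g x := by
    rw [integral_mul_fourierInv ψ hg, ← Lp.fourierInv_toTemperedDistribution_eq,
      TemperedDistribution.fourierInv_apply, Lp.toTemperedDistribution_apply]
    refine integral_congr_ae ?_
    filter_upwards [hg₂.coeFn_toLp] with ξ hξ
    rw [hξ]
  rw [Lp.toTemperedDistribution_apply] at hdual
  simpa [ψ] using hdual

theorem memLp_fourierInv (hg : Integrable g) (hg₂ : MemLp g 2) : MemLp (𝓕⁻ g) 2 :=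
  (memLp_congr_ae (fourierInv_toLp_ae hg hg₂)).mp (Lp.memLp _)

theorem toLp_fourierInv (hg : Integrable g) (hg₂ : MemLp g 2) :
    (memLp_fourierInv hg hg₂).toLp (𝓕⁻ g) = 𝓕⁻ (hg₂.toLp g) :=
  Lp.ext ((memLp_fourierInv hg hg₂).coeFn_toLp.trans (fourierInv_toLp_ae hg hg₂).symm)

theorem contDiff_fourierInv (hg : ExpDecay g) : ContDiff ℝ ∞ (𝓕⁻ g) := by
  rw [Real.fourierInv_eq_fourier_comp_neg]
  refine Real.contDiff_fourier fun n _ => ?_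
  simpa [norm_smul] using (hg.comp_neg.integrable_pow_smul n).norm

theorem iteratedDeriv_fourierInv (hg : ExpDecay g) (n : ℕ) :
    iteratedDeriv n (𝓕⁻ g) = 𝓕⁻ fun ξ : ℝ => (2 * Real.pi * Complex.I * ξ) ^ n * g ξ := by
  rw [Real.fourierInv_eq_fourier_comp_neg, Real.fourierInv_eq_fourier_comp_neg,
    Real.iteratedDeriv_fourier (N := ⊤) (fun n _ => hg.comp_neg.integrable_pow_smul n) le_top]
  simp

theorem fourierInv_mul_convolution {f : ℝ → ℂ} (hf : Integrable f) (hg : Integrable g) (x : ℝ) :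
    𝓕⁻ (f ⋆[ContinuousLinearMap.mul ℝ ℂ] g) x = 𝓕⁻ f x * 𝓕⁻ g x := by
  simp only [Real.fourierInv_eq_fourier_neg]
  exact Real.fourier_mul_convolution_eq hf hg (-x)

theorem fourierInv_add_apply {f : ℝ → ℂ} (hf : Integrable f) (hg : Integrable g) (x : ℝ) :
    𝓕⁻ (f + g) x = 𝓕⁻ f x + 𝓕⁻ g x := by
  simp only [Real.fourierInv_eq_fourier_neg, Real.fourier_eq, Pi.add_apply, smul_add]
  exact integral_add ((Real.fourierIntegral_convergent_iff (-x)).mpr hf)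
    ((Real.fourierIntegral_convergent_iff (-x)).mpr hg)

theorem fourierInv_const_mul (c : ℂ) (f : ℝ → ℂ) (x : ℝ) :
    𝓕⁻ (fun ξ => c * f ξ) x = c * 𝓕⁻ f x := by
  simp only [Real.fourierInv_eq', smul_eq_mul, mul_left_comm _ c, integral_const_mul]

theorem hasDerivAt_fourierInv {G G' : ℝ → ℝ → ℂ} {φ : ℝ → ℝ} {t : ℝ} {s : Set ℝ} (hs : s ∈ 𝓝 t)
    (hG : ∀ τ, Continuous (G τ)) (hGt : Integrable (G t)) (hG' : Continuous (G' t))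
    (hφ : Integrable φ) (hbound : ∀ τ ∈ s, ∀ ξ, ‖G' τ ξ‖ ≤ φ ξ)
    (hderiv : ∀ τ ∈ s, ∀ ξ, HasDerivAt (fun τ => G τ ξ) (G' τ ξ) τ) (x : ℝ) :
    HasDerivAt (fun τ => 𝓕⁻ (G τ) x) (𝓕⁻ (G' t) x) t := by
  simp only [Real.fourierInv_eq']
  set e : ℝ → ℂ := fun ξ => Complex.exp (((2 * Real.pi * inner ℝ ξ x : ℝ) : ℂ) * Complex.I)
  have he : Continuous e := by fun_prop
  have he_norm : ∀ ξ, ‖e ξ‖ = 1 := fun ξ => Complex.norm_exp_ofReal_mul_I _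
  refine (hasDerivAt_integral_of_dominated_loc_of_deriv_le hs (bound := φ)
    (F := fun τ ξ => e ξ • G τ ξ) (F' := fun τ ξ => e ξ • G' τ ξ)
    (Eventually.of_forall fun τ => (he.smul (hG τ)).aestronglyMeasurable)
    (hGt.bdd_smul 1 he.aestronglyMeasurable (Eventually.of_forall fun ξ => (he_norm ξ).le))
    (he.smul hG').aestronglyMeasurable
    (Eventually.of_forall fun ξ τ hτ => ?_) hφ
    (Eventually.of_forall fun ξ τ hτ => (hderiv τ hτ ξ).fun_const_smul _)).2
  rw [norm_smul, he_norm, one_mul]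
  exact hbound τ hτ ξ

theorem conj_fourierInv (hg : ∀ ξ, g (-ξ) = conj (g ξ)) (x : ℝ) : conj (𝓕⁻ g x) = 𝓕⁻ g x := by
  rw [Real.fourierInv_eq', ← integral_conj, ← integral_neg_eq_self]
  refine integral_congr_ae (Eventually.of_forall fun ξ => ?_)
  simp only [smul_eq_mul, map_mul, hg, ← Complex.exp_conj, Complex.conj_conj]
  simp [Complex.conj_ofNat]

end FourierInversion

theorem isValuedIn_of_conj_eq (𝔽 : Subalgebra ℝ ℂ) {f : Lp ℂ 2 (volume : Measure ℝ)}
    (hf : ∀ᵐ x, conj (f x) = f x) : IsValuedIn 𝔽 (Lp.toTemperedDistributionCLM ℂ volume 2 f) := by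
  intro φ hφ
  rw [Lp.toTemperedDistributionCLM_apply, Lp.toTemperedDistribution_apply]
  have hreal : conj (∫ x, φ x • f x) = ∫ x, φ x • f x := by
    rw [← integral_conj]
    refine integral_congr_ae ?_
    filter_upwards [hf] with x hx
    rw [smul_eq_mul, map_mul, hx, Complex.conj_eq_iff_im.mpr (hφ x)]
  obtain ⟨r, hr⟩ := Complex.conj_eq_iff_real.mp hreal
  exact hr ▸ 𝔽.algebraMap_mem r

theorem besselPotential_fourierInv_toLp {g : ℝ → ℂ} (hg : ExpDecay g) (σ : ℝ) :
    TemperedDistribution.besselPotential ℝ ℂ σ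
      (Lp.toTemperedDistributionCLM ℂ volume 2 (𝓕⁻ (hg.memLp.toLp g)))
    = Lp.toTemperedDistributionCLM ℂ volume 2 (𝓕⁻ ((hg.memLp_weighted σ).toLp (weighted σ g))) := by
  have hmul : TemperedDistribution.smulLeftCLM ℂ
      (fun x : ℝ => (((1 + ‖x‖ ^ 2) ^ (σ / 2) : ℝ) : ℂ))
      (Lp.toTemperedDistribution (hg.memLp.toLp g))
        = Lp.toTemperedDistribution ((hg.memLp_weighted σ).toLp (weighted σ g)) := by
    ext φ
    rw [TemperedDistribution.smulLeftCLM_apply_apply, Lp.toTemperedDistribution_apply,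
      Lp.toTemperedDistribution_apply]
    refine integral_congr_ae ?_
    filter_upwards [hg.memLp.coeFn_toLp, (hg.memLp_weighted σ).coeFn_toLp] with ξ hξ hξ'
    rw [hξ, hξ', SchwartzMap.smulLeftCLM_apply_apply (by fun_prop), weighted, smul_eq_mul,
      smul_eq_mul, smul_eq_mul, mul_left_comm]
    ring
  simp only [Lp.toTemperedDistributionCLM_apply, ← Lp.fourierInv_toTemperedDistribution_eq]
  rw [← hmul, TemperedDistribution.besselPotential,
    TemperedDistribution.fourierMultiplierCLM_apply, FourierTransform.fourier_fourierInv_eq]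

/-- The exponentially decaying Fourier transforms of real-valued functions. Real-valued functions
are `𝔽`-valued for both choices of `𝔽`, so these transforms serve the real and the complex case. -/
def fourierData : Submodule ℝ (ℝ → ℂ) where
  carrier := {g | ExpDecay g ∧ ∀ ξ, g (-ξ) = conj (g ξ)}
  zero_mem' := ⟨⟨continuous_const, isBigO_zero _ _⟩, fun ξ => by simp⟩
  add_mem' := fun ⟨hf, hf'⟩ ⟨hg, hg'⟩ =>
    ⟨⟨hf.continuous.add hg.continuous, hf.isBigO.add hg.isBigO⟩, fun ξ => by simp [hf' ξ, hg' ξ]⟩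
  smul_mem' := fun c _ ⟨hf, hf'⟩ =>
    ⟨⟨hf.continuous.const_smul c, hf.isBigO.const_smul_left c⟩, fun ξ => by simp [hf' ξ]⟩

instance : CoeFun fourierData fun _ => ℝ → ℂ := ⟨Subtype.val⟩

variable {𝔽 : Subalgebra ℝ ℂ} {σ : ℝ}

/-- The element of `H^σ` with a given Fourier transform. -/
def ofFourier (𝔽 : Subalgebra ℝ ℂ) (σ : ℝ) : fourierData →ₗ[ℝ] SobolevSpace 𝔽 σ where
  toFun g := (⟨Lp.toTemperedDistributionCLM ℂ volume 2 (𝓕⁻ (g.2.1.memLp.toLp g)),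
    ⟨_, besselPotential_fourierInv_toLp g.2.1 σ⟩, isValuedIn_of_conj_eq 𝔽 <| by
      filter_upwards [fourierInv_toLp_ae g.2.1.integrable g.2.1.memLp] with x hx
      rw [hx, conj_fourierInv g.2.2]⟩ : sobolevSubmodule 𝔽 σ)
  map_add' g h := Subtype.ext <| (congrArg (Lp.toTemperedDistributionCLM ℂ volume 2)
    (FourierTransform.fourierInv_add (g.2.1.memLp.toLp g) (h.2.1.memLp.toLp h))).trans
    (map_add _ _ _)
  map_smul' c g := Subtype.ext <| (congrArg (Lp.toTemperedDistributionCLM ℂ volume 2)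
    (FourierTransform.fourierInv_smul (c : ℂ) (g.2.1.memLp.toLp g))).trans (map_smul _ (c : ℂ) _)

theorem isGivenBy_ofFourier (g : fourierData) : (ofFourier 𝔽 σ g).IsGivenBy (𝓕⁻ (g : ℝ → ℂ)) :=
  ⟨memLp_fourierInv g.2.1.integrable g.2.1.memLp,
    congrArg (Lp.toTemperedDistributionCLM ℂ volume 2)
      (toLp_fourierInv g.2.1.integrable g.2.1.memLp).symm⟩

theorem norm_ofFourier_sq (g : fourierData) :
    ‖ofFourier 𝔽 σ g‖ ^ 2 = ∫ ξ, (1 + ξ ^ 2) ^ σ * ‖g ξ‖ ^ 2 := by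
  have hbessel : SobolevSpace.bessel (ofFourier 𝔽 σ g)
      = 𝓕⁻ ((g.2.1.memLp_weighted σ).toLp (weighted σ g)) :=
    SobolevSpace.toTempered_injective <| (SobolevSpace.bessel_spec _).symm.trans
      (besselPotential_fourierInv_toLp g.2.1 σ)
  have hnorm : ‖ofFourier 𝔽 σ g‖ = ‖(g.2.1.memLp_weighted σ).toLp (weighted σ g)‖ :=
    (congrArg norm hbessel).trans ((Lp.fourierTransformₗᵢ ℝ ℂ).symm.norm_map _)
  rw [hnorm, Lp.norm_toLp, ← integral_congr_ae (Eventually.of_forall (norm_weighted_sq σ g)),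
    (g.2.1.memLp_weighted σ).eLpNorm_eq_integral_rpow_norm (by norm_num) (by norm_num),
    ENNReal.toReal_ofReal (by positivity), ← Real.rpow_natCast, ← Real.rpow_mul (by positivity)]
  norm_num

end Sobolev

section Weights

/-- The weight `e^{-r|ξ|} / (1 + ξ²)` on the frequency side. The exponential measures analyticity
in a strip of width `r`; the rational factor makes the weighted functions a convolution algebra. -/
def expWeight (r ξ : ℝ) : ℝ := Real.exp (-(r * |ξ|)) / (1 + ξ ^ 2)

theorem expWeight_pos (r ξ : ℝ) : 0 < expWeight r ξ := by unfold expWeight; positivity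

theorem expWeight_neg (r ξ : ℝ) : expWeight r (-ξ) = expWeight r ξ := by simp [expWeight]

theorem continuous_expWeight : Continuous fun p : ℝ × ℝ => expWeight p.1 p.2 :=
  Continuous.div (by fun_prop) (by fun_prop) fun p => by positivity

theorem expWeight_anti (ξ : ℝ) : Antitone fun r => expWeight r ξ := by
  intro r r' h
  simp only [expWeight]
  gcongr

theorem expWeight_one_le (ξ : ℝ) : expWeight 1 ξ ≤ Real.exp (-|ξ|) := by
  rw [expWeight, one_mul]
  exact div_le_self (Real.exp_pos _).le (by nlinarith [sq_nonneg ξ])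

theorem abs_mul_expWeight_one_le (ξ : ℝ) : |ξ| * expWeight 1 ξ ≤ Real.exp (-|ξ|) := by
  rw [expWeight, one_mul, mul_div_left_comm]
  refine mul_le_of_le_one_right (Real.exp_pos _).le ?_
  rw [div_le_one (by positivity)]
  nlinarith [sq_abs ξ, sq_nonneg (|ξ| - 1)]

theorem inv_one_add_sq_mul_inv_le (ξ η : ℝ) :
    (1 + η ^ 2)⁻¹ * (1 + (ξ - η) ^ 2)⁻¹
      ≤ (1 + ξ ^ 2)⁻¹ * (2 * (1 + η ^ 2)⁻¹ + 2 * (1 + (ξ - η) ^ 2)⁻¹) := by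
  rw [← sub_nonneg]
  have hdiff : (1 + ξ ^ 2)⁻¹ * (2 * (1 + η ^ 2)⁻¹ + 2 * (1 + (ξ - η) ^ 2)⁻¹)
      - (1 + η ^ 2)⁻¹ * (1 + (ξ - η) ^ 2)⁻¹ = (3 + (ξ - 2 * η) ^ 2)
        * ((1 + ξ ^ 2)⁻¹ * (1 + η ^ 2)⁻¹ * (1 + (ξ - η) ^ 2)⁻¹) := by field_simp; ring
  rw [hdiff]
  positivity

theorem expWeight_mul_le {r : ℝ} (hr : 0 ≤ r) (ξ η : ℝ) :
    expWeight r η * expWeight r (ξ - η)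
      ≤ expWeight r ξ * (2 * (1 + η ^ 2)⁻¹ + 2 * (1 + (ξ - η) ^ 2)⁻¹) := by
  have htri : |ξ| ≤ |η| + |ξ - η| := by simpa using abs_add_le η (ξ - η)
  have hexp : Real.exp (-(r * |η|)) * Real.exp (-(r * |ξ - η|)) ≤ Real.exp (-(r * |ξ|)) := by
    rw [← Real.exp_add]
    exact Real.exp_le_exp.mpr (by nlinarith)
  simp only [expWeight, div_eq_mul_inv]
  calc _ = Real.exp (-(r * |η|)) * Real.exp (-(r * |ξ - η|))
        * ((1 + η ^ 2)⁻¹ * (1 + (ξ - η) ^ 2)⁻¹) := by ring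
    _ ≤ Real.exp (-(r * |ξ|))
        * ((1 + ξ ^ 2)⁻¹ * (2 * (1 + η ^ 2)⁻¹ + 2 * (1 + (ξ - η) ^ 2)⁻¹)) :=
        mul_le_mul hexp (inv_one_add_sq_mul_inv_le ξ η) (by positivity) (by positivity)
    _ = _ := by ring

theorem integral_inv_one_add_sq_add (ξ : ℝ) :
    ∫ η : ℝ, (2 * (1 + η ^ 2)⁻¹ + 2 * (1 + (ξ - η) ^ 2)⁻¹) = 4 * Real.pi := by
  rw [integral_add (integrable_inv_one_add_sq.const_mul _)
    ((integrable_inv_one_add_sq.comp_sub_left ξ).const_mul _), integral_const_mul,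
    integral_const_mul, integral_sub_left_eq_self (fun η : ℝ => (1 + η ^ 2)⁻¹) volume ξ,
    integral_univ_inv_one_add_sq]
  ring

theorem norm_convolution_le_expWeight {f g : ℝ → ℂ} {r M N : ℝ} (hr : 0 ≤ r)
    (hf : ∀ ξ, ‖f ξ‖ ≤ M * expWeight r ξ) (hg : ∀ ξ, ‖g ξ‖ ≤ N * expWeight r ξ) (ξ : ℝ) :
    ‖(f ⋆[ContinuousLinearMap.mul ℝ ℂ] g) ξ‖ ≤ 4 * Real.pi * (M * N) * expWeight r ξ := by
  have hM : 0 ≤ M := nonneg_of_mul_nonneg_left ((norm_nonneg _).trans (hf 0)) (expWeight_pos r 0)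
  have hN : 0 ≤ N := nonneg_of_mul_nonneg_left ((norm_nonneg _).trans (hg 0)) (expWeight_pos r 0)
  have hbound : ∀ η, ‖f η * g (ξ - η)‖
      ≤ M * N * expWeight r ξ * (2 * (1 + η ^ 2)⁻¹ + 2 * (1 + (ξ - η) ^ 2)⁻¹) := fun η => calc
    ‖f η * g (ξ - η)‖ ≤ (M * expWeight r η) * (N * expWeight r (ξ - η)) := by
        rw [norm_mul]
        exact mul_le_mul (hf η) (hg _) (norm_nonneg _) ((norm_nonneg _).trans (hf η))
    _ = M * N * (expWeight r η * expWeight r (ξ - η)) := by ring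
    _ ≤ M * N * (expWeight r ξ * (2 * (1 + η ^ 2)⁻¹ + 2 * (1 + (ξ - η) ^ 2)⁻¹)) :=
        mul_le_mul_of_nonneg_left (expWeight_mul_le hr ξ η) (mul_nonneg hM hN)
    _ = _ := by ring
  refine (norm_integral_le_of_norm_le (((integrable_inv_one_add_sq.const_mul 2).add
    ((integrable_inv_one_add_sq.comp_sub_left ξ).const_mul 2)).const_mul _)
    (Eventually.of_forall hbound)).trans_eq ?_
  simp only [Pi.add_apply]
  rw [integral_const_mul, integral_inv_one_add_sq_add]
  ring

theorem integral_abs_mul_expWeight_le (a t ξ : ℝ) :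
    ∫ τ in 0..t, |ξ| * expWeight (a - τ) ξ ≤ expWeight (a - t) ξ := by
  have hderiv : ∀ τ, HasDerivAt (fun τ => expWeight (a - τ) ξ) (|ξ| * expWeight (a - τ) ξ) τ := by
    intro τ
    have hexponent : HasDerivAt (fun τ => -((a - τ) * |ξ|)) |ξ| τ := by
      simpa using (((hasDerivAt_id τ).const_sub a).mul_const |ξ|).fun_neg
    convert! (hexponent.exp).div_const (1 + ξ ^ 2) using 1
    rw [expWeight]
    ring
  have hcont : Continuous fun τ => |ξ| * expWeight (a - τ) ξ := continuous_const.mul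
    (continuous_expWeight.comp (by fun_prop : Continuous fun τ : ℝ => (a - τ, ξ)))
  rw [intervalIntegral.integral_eq_sub_of_hasDerivAt (fun τ _ => hderiv τ)
    (hcont.intervalIntegrable _ _)]
  exact sub_le_self _ (expWeight_pos _ _).le

end Weights

section Source

theorem ExpDecay.convolutionExists {f g : ℝ → ℂ} (hf : ExpDecay f) (hg : ExpDecay g) :
    ConvolutionExists f g (ContinuousLinearMap.mul ℝ ℂ) := by
  obtain ⟨M, hM⟩ := hg.exists_norm_le
  have hM0 : 0 ≤ M := by simpa using (norm_nonneg _).trans (hM 0)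
  refine fun ξ => hf.integrable.mul_bdd (c := M)
    (hg.continuous.comp (continuous_sub_left ξ)).aestronglyMeasurable
    (Eventually.of_forall fun η => (hM _).trans ?_)
  exact mul_le_of_le_one_right hM0 (Real.exp_le_one_iff.mpr (by simp))

theorem continuous_convolution_of_norm_le {X : Type*} [TopologicalSpace X]
    [FirstCountableTopology X] {f g : X → ℝ → ℂ} {φ : ℝ → ℝ} {N : ℝ}
    (hf : Continuous (Function.uncurry f)) (hg : Continuous (Function.uncurry g))
    (hφ : Integrable φ) (hfφ : ∀ x η, ‖f x η‖ ≤ φ η) (hgN : ∀ x ξ, ‖g x ξ‖ ≤ N) :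
    Continuous fun p : X × ℝ => (f p.1 ⋆[ContinuousLinearMap.mul ℝ ℂ] g p.1) p.2 := by
  refine continuous_of_dominated (bound := fun η => φ η * N)
    (fun p => Continuous.aestronglyMeasurable ?_) (fun p => Eventually.of_forall fun η => ?_)
    (hφ.mul_const N) (Eventually.of_forall fun η => ?_)
  · exact (hf.comp (by fun_prop : Continuous fun η : ℝ => (p.1, η))).mul
      (hg.comp (by fun_prop : Continuous fun η : ℝ => (p.1, p.2 - η)))
  · exact (norm_mul_le _ _).trans (mul_le_mul (hfφ _ _) (hgN _ _) (norm_nonneg _)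
      ((norm_nonneg _).trans (hfφ p.1 η)))
  · exact (hf.comp (by fun_prop : Continuous fun p : X × ℝ => (p.1, η))).mul
      (hg.comp (by fun_prop : Continuous fun p : X × ℝ => (p.1, p.2 - η)))

/-- The Fourier transform of `-(uv)_x`, in terms of the Fourier transforms `f` of `u` and `g` of
`v`. -/
def source (f g : ℝ → ℂ) (ξ : ℝ) : ℂ :=
  -(2 * Real.pi * ξ * Complex.I) * (f ⋆[ContinuousLinearMap.mul ℝ ℂ] g) ξ

variable {f f' g : ℝ → ℂ}

theorem source_comm (f g : ℝ → ℂ) : source f g = source g f := by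
  ext ξ
  rw [source, source, ← convolution_flip, ContinuousLinearMap.flip_mul]

theorem source_add_left (hf : ExpDecay f) (hf' : ExpDecay f') (hg : ExpDecay g) :
    source (f + f') g = source f g + source f' g := by
  ext ξ
  simp only [source, Pi.add_apply, mul_add,
    (hf.convolutionExists hg).add_distrib (hf'.convolutionExists hg)]

theorem source_smul_left (c : ℝ) (f g : ℝ → ℂ) : source (c • f) g = c • source f g := by
  ext ξ
  simp only [source, smul_convolution, Pi.smul_apply, mul_smul_comm]

theorem norm_source_le {r M N : ℝ} (hr : 0 ≤ r) (hf : ∀ ξ, ‖f ξ‖ ≤ M * expWeight r ξ)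
    (hg : ∀ ξ, ‖g ξ‖ ≤ N * expWeight r ξ) (ξ : ℝ) :
    ‖source f g ξ‖ ≤ 8 * Real.pi ^ 2 * (M * N) * (|ξ| * expWeight r ξ) := by
  have hsymbol : ‖-(2 * Real.pi * ξ * Complex.I : ℂ)‖ = 2 * Real.pi * |ξ| := by
    simp [abs_of_pos Real.pi_pos]
  rw [source, norm_mul, hsymbol]
  exact (mul_le_mul_of_nonneg_left (norm_convolution_le_expWeight hr hf hg ξ)
    (by positivity)).trans_eq (by ring)

theorem source_neg (hf : ∀ ξ, f (-ξ) = conj (f ξ)) (hg : ∀ ξ, g (-ξ) = conj (g ξ)) (ξ : ℝ) :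
    source f g (-ξ) = conj (source f g ξ) := by
  have hconv : (f ⋆[ContinuousLinearMap.mul ℝ ℂ] g) (-ξ)
      = conj ((f ⋆[ContinuousLinearMap.mul ℝ ℂ] g) ξ) := by
    rw [convolution, convolution, ← integral_conj, ← integral_neg_eq_self]
    refine integral_congr_ae (Eventually.of_forall fun η => ?_)
    simp only [ContinuousLinearMap.mul_apply', map_mul, ← hf, ← hg]
    congr 2
    ring
  rw [source, source, hconv]
  simp [Complex.conj_ofNat]

theorem fourierInv_source (hf : Integrable f) (hg : Integrable g)
    (hfg : ExpDecay (f ⋆[ContinuousLinearMap.mul ℝ ℂ] g)) (x : ℝ) :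
    𝓕⁻ (source f g) x = -deriv (fun y => 𝓕⁻ f y * 𝓕⁻ g y) x := by
  simp only [← fourierInv_mul_convolution hf hg]
  rw [← iteratedDeriv_one, iteratedDeriv_fourierInv hfg, Real.fourierInv_eq', Real.fourierInv_eq',
    ← integral_neg]
  refine integral_congr_ae (Eventually.of_forall fun ξ => ?_)
  simp only [source, smul_eq_mul]
  ring

end Source

section Duhamel

/-- The symbol of `-α ∂ₓ³ - β ∂ₓ`, divided by `i`. -/
def dispersion (α β ξ : ℝ) : ℝ := α * (2 * Real.pi * ξ) ^ 3 - β * (2 * Real.pi * ξ)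

/-- The propagator of `u_t + α u_xxx + β u_x = 0` on the frequency side. -/
def propagator (α β t ξ : ℝ) : ℂ := Complex.exp ((t * dispersion α β ξ : ℝ) * Complex.I)

variable (α β : ℝ)

theorem continuous_propagator : Continuous fun p : ℝ × ℝ => propagator α β p.1 p.2 := by
  unfold propagator dispersion
  fun_prop

theorem norm_propagator (t ξ : ℝ) : ‖propagator α β t ξ‖ = 1 := Complex.norm_exp_ofReal_mul_I _

theorem propagator_zero (ξ : ℝ) : propagator α β 0 ξ = 1 := by simp [propagator]

theorem propagator_neg (t ξ : ℝ) : propagator α β t (-ξ) = conj (propagator α β t ξ) := by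
  have hodd : dispersion α β (-ξ) = -dispersion α β ξ := by unfold dispersion; ring
  rw [propagator, propagator, ← Complex.exp_conj, hodd]
  simp

theorem propagator_add (t t' ξ : ℝ) :
    propagator α β (t + t') ξ = propagator α β t ξ * propagator α β t' ξ := by
  simp only [propagator, ← Complex.exp_add, add_mul, Complex.ofReal_add]

theorem hasDerivAt_propagator (t ξ : ℝ) : HasDerivAt (fun t => propagator α β t ξ)
    (dispersion α β ξ * Complex.I * propagator α β t ξ) t := by
  have hphase : HasDerivAt (fun t : ℝ => ((t * dispersion α β ξ : ℝ) : ℂ) * Complex.I)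
      (dispersion α β ξ * Complex.I) t := by
    simpa using (((hasDerivAt_id t).mul_const (dispersion α β ξ)).ofReal_comp).mul_const Complex.I
  exact hphase.cexp.congr_deriv (mul_comm _ _)

/-- The Duhamel integral: the Fourier transform of the solution of
`u_t + α u_xxx + β u_x = F`, `u|_{t=0} = 0`. -/
def duhamel (F : ℝ → ℝ → ℂ) (t ξ : ℝ) : ℂ := ∫ τ in 0..t, propagator α β (t - τ) ξ * F τ ξ

variable {F G : ℝ → ℝ → ℂ}

theorem continuous_duhamel_integrand (hF : Continuous (Function.uncurry F)) :
    Continuous fun p : (ℝ × ℝ) × ℝ => propagator α β (p.1.1 - p.2) p.1.2 * F p.2 p.1.2 :=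
  ((continuous_propagator α β).comp (by fun_prop :
    Continuous fun p : (ℝ × ℝ) × ℝ => (p.1.1 - p.2, p.1.2))).mul
    (hF.comp (by fun_prop : Continuous fun p : (ℝ × ℝ) × ℝ => (p.2, p.1.2)))

theorem continuous_duhamel (hF : Continuous (Function.uncurry F)) :
    Continuous (Function.uncurry (duhamel α β F)) :=
  intervalIntegral.continuous_parametric_intervalIntegral_of_continuous
    (f := fun (p : ℝ × ℝ) τ => propagator α β (p.1 - τ) p.2 * F τ p.2)
    (continuous_duhamel_integrand α β hF) continuous_fst

theorem duhamel_add (hF : Continuous (Function.uncurry F)) (hG : Continuous (Function.uncurry G)) :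
    duhamel α β (F + G) = duhamel α β F + duhamel α β G := by
  ext t ξ
  have hint : ∀ {H : ℝ → ℝ → ℂ}, Continuous (Function.uncurry H) →
      IntervalIntegrable (fun τ => propagator α β (t - τ) ξ * H τ ξ) volume 0 t := fun hH =>
    ((continuous_duhamel_integrand α β hH).comp
      (by fun_prop : Continuous fun τ : ℝ => ((t, ξ), τ))).intervalIntegrable _ _
  simp only [duhamel, Pi.add_apply, mul_add]
  exact intervalIntegral.integral_add (hint hF) (hint hG)

theorem duhamel_smul (c : ℝ) (F : ℝ → ℝ → ℂ) : duhamel α β (c • F) = c • duhamel α β F := by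
  ext t ξ
  simp only [duhamel, Pi.smul_apply, mul_smul_comm, intervalIntegral.integral_smul]

theorem duhamel_neg (hF : ∀ t ξ, F t (-ξ) = conj (F t ξ)) (t ξ : ℝ) :
    duhamel α β F t (-ξ) = conj (duhamel α β F t ξ) := by
  simp only [duhamel, propagator_neg, hF, ← map_mul, intervalIntegral, integral_conj, map_sub]

theorem hasDerivAt_duhamel (hF : Continuous (Function.uncurry F)) (t ξ : ℝ) :
    HasDerivAt (fun t => duhamel α β F t ξ)
      (dispersion α β ξ * Complex.I * duhamel α β F t ξ + F t ξ) t := by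
  have hfactor : ∀ t, duhamel α β F t ξ
      = propagator α β t ξ * ∫ τ in 0..t, propagator α β (-τ) ξ * F τ ξ := fun t => by
    rw [duhamel, ← intervalIntegral.integral_const_mul]
    simp only [sub_eq_add_neg, propagator_add, mul_assoc]
  have hcont : Continuous fun τ : ℝ => propagator α β (-τ) ξ * F τ ξ := by
    simpa [Function.comp_def] using (continuous_duhamel_integrand α β hF).comp
      (by fun_prop : Continuous fun τ : ℝ => (((0 : ℝ), ξ), τ))
  have hcancel : propagator α β t ξ * propagator α β (-t) ξ = 1 := by
    rw [← propagator_add, add_neg_cancel, propagator_zero]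
  simp only [hfactor]
  refine ((hasDerivAt_propagator α β t ξ).mul
    (hcont.integral_hasStrictDerivAt 0 t).hasDerivAt).congr_deriv ?_
  linear_combination F t ξ * hcancel

theorem norm_duhamel_le_of_norm_le {K : ℝ} {ξ : ℝ} (hF : ∀ τ, ‖F τ ξ‖ ≤ K) (t : ℝ) :
    ‖duhamel α β F t ξ‖ ≤ K * |t| := by
  simpa [duhamel] using intervalIntegral.norm_integral_le_of_norm_le_const (a := 0) (b := t)
    (C := K) (f := fun τ => propagator α β (t - τ) ξ * F τ ξ)
    fun τ _ => by rw [norm_mul, norm_propagator, one_mul]; exact hF τ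

/-- The derivative in `F` costs a factor `|ξ|`, which is recovered by integrating in time a weight
whose exponential rate decreases: this is the Cauchy-Kovalevskaya mechanism. -/
theorem norm_duhamel_le_expWeight {K a t ξ : ℝ} (hK : 0 ≤ K) (ht : 0 ≤ t)
    (hF : ∀ τ ∈ Icc 0 t, ‖F τ ξ‖ ≤ K * (|ξ| * expWeight (a - τ) ξ)) :
    ‖duhamel α β F t ξ‖ ≤ K * expWeight (a - t) ξ := by
  have hcont : Continuous fun τ => |ξ| * expWeight (a - τ) ξ := continuous_const.mul
    (continuous_expWeight.comp (by fun_prop : Continuous fun τ : ℝ => (a - τ, ξ)))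
  calc ‖duhamel α β F t ξ‖ ≤ ∫ τ in 0..t, K * (|ξ| * expWeight (a - τ) ξ) :=
        intervalIntegral.norm_integral_le_of_norm_le ht (Eventually.of_forall fun τ hτ => by
          rw [norm_mul, norm_propagator, one_mul]; exact hF τ (Ioc_subset_Icc_self hτ))
          ((hcont.const_mul K).intervalIntegrable _ _)
    _ = K * ∫ τ in 0..t, |ξ| * expWeight (a - τ) ξ := intervalIntegral.integral_const_mul _ _
    _ ≤ K * expWeight (a - t) ξ :=
        mul_le_mul_of_nonneg_left (integral_abs_mul_expWeight_le a t ξ) hK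

end Duhamel

section Amplitudes

open scoped NNReal

/-- Bounded continuous functions `A` on `[0,T] × ℝ` with `A(t,-ξ)` conjugate to `A(t,ξ)`. Multiplied
by `expWeight`, they are the Fourier transforms in `x` of the real-valued waves among which the
system is solved. -/
def amplitudes (T : ℝ≥0) : Submodule ℝ ((Icc (0 : ℝ) T × ℝ) →ᵇ ℂ) where
  carrier := {A | ∀ t ξ, A (t, -ξ) = conj (A (t, ξ))}
  zero_mem' := fun _ _ => by simp
  add_mem' := fun hA hB t ξ => by simp [hA t ξ, hB t ξ]
  smul_mem' := fun c A hA t ξ => by simp [hA t ξ]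

variable {T : ℝ≥0}

instance : CompleteSpace (amplitudes T) := by
  have hinter : (amplitudes T : Set ((Icc (0 : ℝ) T × ℝ) →ᵇ ℂ))
      = ⋂ (t) (ξ), {A | A (t, -ξ) = conj (A (t, ξ))} := by ext A; simp [amplitudes]
  have hclosed : IsClosed (amplitudes T : Set ((Icc (0 : ℝ) T × ℝ) →ᵇ ℂ)) := by
    rw [hinter]
    exact isClosed_iInter fun t => isClosed_iInter fun ξ =>
      isClosed_eq (by fun_prop) (by fun_prop)
  exact hclosed.completeSpace_coe

/-- The projection of the line to the time interval `[0,T]`. -/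
def projTime (T : ℝ≥0) : ℝ → Icc (0 : ℝ) T := projIcc 0 (T : ℝ) T.coe_nonneg

theorem projTime_of_mem {t : ℝ} (ht : t ∈ Icc 0 (T : ℝ)) : projTime T t = ⟨t, ht⟩ :=
  projIcc_of_mem _ ht

theorem continuous_projTime : Continuous (projTime T) := continuous_projIcc

/-- The exponential rate `1 + T - t` at time `t`, with `t` projected to `[0,T]`. -/
def rate (T : ℝ≥0) (t : ℝ) : ℝ := 1 + T - projTime T t

theorem one_le_rate (t : ℝ) : 1 ≤ rate T t := by
  unfold rate
  linarith [(projTime T t).2.2]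

theorem rate_of_mem {t : ℝ} (ht : t ∈ Icc 0 (T : ℝ)) : rate T t = 1 + T - t := by
  rw [rate, projTime_of_mem ht]

theorem continuous_rate : Continuous (rate T) :=
  continuous_const.sub (continuous_subtype_val.comp continuous_projTime)

theorem continuous_expWeight_rate_mul (A : (Icc (0 : ℝ) T × ℝ) →ᵇ ℂ) :
    Continuous fun p : ℝ × ℝ =>
      (expWeight (rate T p.1) p.2 : ℂ) * A (projTime T p.1, p.2) :=
  (Complex.continuous_ofReal.comp (continuous_expWeight.comp
    ((continuous_rate.comp continuous_fst).prodMk continuous_snd))).mul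
    (A.continuous.comp ((continuous_projTime.comp continuous_fst).prodMk continuous_snd))

theorem norm_expWeight_mul_le (A : (Icc (0 : ℝ) T × ℝ) →ᵇ ℂ) (r ξ : ℝ) (t : Icc (0 : ℝ) T) :
    ‖(expWeight r ξ : ℂ) * A (t, ξ)‖ ≤ ‖A‖ * expWeight r ξ := by
  rw [norm_mul, Complex.norm_real, Real.norm_of_nonneg (expWeight_pos _ _).le, mul_comm]
  exact mul_le_mul_of_nonneg_right (A.norm_coe_le_norm _) (expWeight_pos _ _).le

theorem expWeight_le_exp {r : ℝ} (hr : 1 ≤ r) (ξ : ℝ) : expWeight r ξ ≤ Real.exp (-|ξ|) :=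
  (expWeight_anti ξ hr).trans (expWeight_one_le ξ)

theorem expWeight_rate_mul_mem_fourierData (A : amplitudes T) (t : ℝ) :
    (fun ξ => (expWeight (rate T t) ξ : ℂ) * A.1 (projTime T t, ξ)) ∈ fourierData := by
  have hcont : Continuous fun ξ => (expWeight (rate T t) ξ : ℂ) * A.1 (projTime T t, ξ) := by
    simpa only [Function.comp_def] using
      (continuous_expWeight_rate_mul A.1).comp (Continuous.prodMk_right t)
  have hle : ∀ ξ, ‖(expWeight (rate T t) ξ : ℂ) * A.1 (projTime T t, ξ)‖
      ≤ ‖A.1‖ * Real.exp (-|ξ|) := fun ξ => (norm_expWeight_mul_le A.1 _ ξ _).trans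
    (mul_le_mul_of_nonneg_left (expWeight_le_exp (one_le_rate t) ξ) (norm_nonneg _))
  refine ⟨ExpDecay.of_norm_le hcont hle, fun ξ => ?_⟩
  have hconj : A.1 (projTime T t, -ξ) = conj (A.1 (projTime T t, ξ)) := A.2 _ ξ
  simp only [expWeight_neg, hconj, map_mul, Complex.conj_ofReal]

/-- The Fourier transform at time `t` of the wave with a given amplitude. -/
def slice (t : ℝ) : amplitudes T →ₗ[ℝ] fourierData where
  toFun A := ⟨_, expWeight_rate_mul_mem_fourierData A t⟩
  map_add' A B := Subtype.ext <| funext fun ξ => by simp [mul_add]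
  map_smul' c A := Subtype.ext <| funext fun ξ => by simp [mul_left_comm]

theorem slice_apply (t : ℝ) (A : amplitudes T) (ξ : ℝ) :
    slice t A ξ = expWeight (rate T t) ξ * A.1 (projTime T t, ξ) := rfl

theorem continuous_slice (A : amplitudes T) : Continuous fun p : ℝ × ℝ => slice p.1 A p.2 :=
  continuous_expWeight_rate_mul A.1

theorem norm_slice_le (t : ℝ) (A : amplitudes T) (ξ : ℝ) :
    ‖slice t A ξ‖ ≤ ‖A‖ * expWeight (rate T t) ξ := norm_expWeight_mul_le A.1 _ ξ _

theorem norm_slice_le_exp (t : ℝ) (A : amplitudes T) (ξ : ℝ) :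
    ‖slice t A ξ‖ ≤ ‖A‖ * Real.exp (-|ξ|) :=
  (norm_slice_le t A ξ).trans
    (mul_le_mul_of_nonneg_left (expWeight_le_exp (one_le_rate t) ξ) (norm_nonneg _))

theorem amplitudes_ext {A B : amplitudes T}
    (h : ∀ t ∈ Icc 0 (T : ℝ), (slice t A : ℝ → ℂ) = slice t B) : A = B := by
  refine Subtype.ext (DFunLike.ext _ _ fun ⟨t, ξ⟩ => ?_)
  have hslice := congrFun (h t t.2) ξ
  rw [slice_apply, slice_apply, projTime_of_mem t.2] at hslice
  exact mul_left_cancel₀ (Complex.ofReal_ne_zero.mpr (expWeight_pos _ _).ne') hslice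

theorem exists_amplitude {f : ℝ → ℝ → ℂ} {M : ℝ} (hM : 0 ≤ M)
    (hf : Continuous (Function.uncurry f)) (hconj : ∀ t ξ, f t (-ξ) = conj (f t ξ))
    (hbound : ∀ t ∈ Icc 0 (T : ℝ), ∀ ξ, ‖f t ξ‖ ≤ M * expWeight (1 + T - t) ξ) :
    ∃ A : amplitudes T, ‖A‖ ≤ M ∧ ∀ t ∈ Icc 0 (T : ℝ), (slice t A : ℝ → ℂ) = f t := by
  have hcont : Continuous fun p : Icc (0 : ℝ) T × ℝ =>
      (expWeight (1 + T - p.1) p.2 : ℂ)⁻¹ * f p.1 p.2 := by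
    refine Continuous.mul (Continuous.inv₀ (Complex.continuous_ofReal.comp
      (continuous_expWeight.comp (by fun_prop :
        Continuous fun p : Icc (0 : ℝ) T × ℝ => (1 + (T : ℝ) - p.1, p.2)))) fun p => ?_)
      (hf.comp (by fun_prop : Continuous fun p : Icc (0 : ℝ) T × ℝ => ((p.1 : ℝ), p.2)))
    exact Complex.ofReal_ne_zero.mpr (expWeight_pos _ _).ne'
  have hle : ∀ p : Icc (0 : ℝ) T × ℝ, ‖(expWeight (1 + T - p.1) p.2 : ℂ)⁻¹ * f p.1 p.2‖ ≤ M := by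
    intro p
    rw [norm_mul, norm_inv, Complex.norm_real, Real.norm_of_nonneg (expWeight_pos _ _).le,
      inv_mul_le_iff₀ (expWeight_pos _ _), mul_comm]
    exact hbound _ p.1.2 _
  refine ⟨⟨.ofNormedAddCommGroup _ hcont M hle, fun t ξ => by simp [hconj, expWeight_neg]⟩,
    BoundedContinuousFunction.norm_ofNormedAddCommGroup_le hcont hM hle, fun t ht => ?_⟩
  ext ξ
  rw [slice_apply, rate_of_mem ht, projTime_of_mem ht]
  exact mul_inv_cancel_left₀ (Complex.ofReal_ne_zero.mpr (expWeight_pos _ _).ne') _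

theorem norm_convolution_slice_le (A B : amplitudes T) (t ξ : ℝ) :
    ‖(slice t A ⋆[ContinuousLinearMap.mul ℝ ℂ] slice t B) ξ‖
      ≤ 4 * Real.pi * (‖A‖ * ‖B‖) * Real.exp (-|ξ|) :=
  (norm_convolution_le_expWeight (zero_le_one.trans (one_le_rate t)) (norm_slice_le t A)
    (norm_slice_le t B) ξ).trans
    (mul_le_mul_of_nonneg_left (expWeight_le_exp (one_le_rate t) ξ) (by positivity))

theorem continuous_convolution_slice (A B : amplitudes T) : Continuous fun p : ℝ × ℝ =>
    (slice p.1 A ⋆[ContinuousLinearMap.mul ℝ ℂ] slice p.1 B) p.2 := by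
  have hexp : Integrable fun η : ℝ => ‖A‖ * Real.exp (-|η|) := by
    simpa only [pow_zero, one_mul] using (integrable_abs_pow_mul_exp 0).const_mul ‖A‖
  refine continuous_convolution_of_norm_le (N := ‖B‖) (f := fun t => slice t A)
    (g := fun t => slice t B) (continuous_slice A) (continuous_slice B) hexp
    (norm_slice_le_exp · A) fun t ξ => (norm_slice_le_exp t B ξ).trans ?_
  exact mul_le_of_le_one_right (norm_nonneg _) (Real.exp_le_one_iff.mpr (by simp))

theorem expDecay_convolution_slice (A B : amplitudes T) (t : ℝ) :
    ExpDecay (slice t A ⋆[ContinuousLinearMap.mul ℝ ℂ] slice t B) := by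
  refine ExpDecay.of_norm_le ?_ (norm_convolution_slice_le A B t)
  simpa only [Function.comp_def] using
    (continuous_convolution_slice A B).comp (Continuous.prodMk_right t)

/-- The Fourier transform of `-(uv)_x` for the waves `u` and `v` with amplitudes `A` and `B`. -/
def waveSource (A B : amplitudes T) (t ξ : ℝ) : ℂ := source (slice t A) (slice t B) ξ

theorem continuous_waveSource (A B : amplitudes T) :
    Continuous (Function.uncurry (waveSource A B)) :=
  Continuous.mul (f := fun p : ℝ × ℝ => -(2 * Real.pi * p.2 * Complex.I)) (by fun_prop)
    (continuous_convolution_slice A B)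

theorem waveSource_neg (A B : amplitudes T) (t ξ : ℝ) :
    waveSource A B t (-ξ) = conj (waveSource A B t ξ) :=
  source_neg (slice t A).2.2 (slice t B).2.2 ξ

theorem norm_waveSource_le (A B : amplitudes T) (t ξ : ℝ) :
    ‖waveSource A B t ξ‖ ≤ 8 * Real.pi ^ 2 * (‖A‖ * ‖B‖) * (|ξ| * expWeight (rate T t) ξ) :=
  norm_source_le (zero_le_one.trans (one_le_rate t)) (norm_slice_le t A) (norm_slice_le t B) ξ

theorem norm_waveSource_le_exp (A B : amplitudes T) (t ξ : ℝ) :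
    ‖waveSource A B t ξ‖ ≤ 8 * Real.pi ^ 2 * (‖A‖ * ‖B‖) * Real.exp (-|ξ|) := by
  refine (norm_waveSource_le A B t ξ).trans (mul_le_mul_of_nonneg_left ?_ (by positivity))
  exact (mul_le_mul_of_nonneg_left (expWeight_anti ξ (one_le_rate t)) (abs_nonneg ξ)).trans
    (abs_mul_expWeight_one_le ξ)

theorem waveSource_comm (A B : amplitudes T) : waveSource A B = waveSource B A := by
  ext t ξ
  rw [waveSource, source_comm, waveSource]

theorem waveSource_add_left (A A' B : amplitudes T) :
    waveSource (A + A') B = waveSource A B + waveSource A' B := by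
  ext t ξ
  simp only [waveSource, map_add, Submodule.coe_add, Pi.add_apply,
    source_add_left (slice t A).2.1 (slice t A').2.1 (slice t B).2.1]

theorem waveSource_smul_left (c : ℝ) (A B : amplitudes T) :
    waveSource (c • A) B = c • waveSource A B := by
  ext t ξ
  simp only [waveSource, map_smul, Submodule.coe_smul, Pi.smul_apply, source_smul_left]

theorem fourierInv_waveSource (A B : amplitudes T) (t x : ℝ) :
    𝓕⁻ (waveSource A B t) x
      = -deriv (fun y => 𝓕⁻ (slice t A : ℝ → ℂ) y * 𝓕⁻ (slice t B : ℝ → ℂ) y) x :=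
  fourierInv_source (slice t A).2.1.integrable (slice t B).2.1.integrable
    (expDecay_convolution_slice A B t) x

theorem exists_duhamel_bilinear (α β : ℝ) :
    ∃ D : amplitudes T →L[ℝ] amplitudes T →L[ℝ] amplitudes T, ∀ A B, ∀ t ∈ Icc 0 (T : ℝ),
      (slice t (D A B) : ℝ → ℂ) = duhamel α β (waveSource A B) t := by
  have hexists : ∀ A B : amplitudes T, ∃ D : amplitudes T, ‖D‖ ≤ 8 * Real.pi ^ 2 * (‖A‖ * ‖B‖) ∧
      ∀ t ∈ Icc 0 (T : ℝ), (slice t D : ℝ → ℂ) = duhamel α β (waveSource A B) t := fun A B =>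
    exists_amplitude (by positivity) (continuous_duhamel α β (continuous_waveSource A B))
      (duhamel_neg α β (waveSource_neg A B)) fun t ht ξ =>
        norm_duhamel_le_expWeight α β (by positivity) ht.1 fun τ hτ => by
          rw [← rate_of_mem ⟨hτ.1, hτ.2.trans ht.2⟩]
          exact norm_waveSource_le A B τ ξ
  choose D hDnorm hD using hexists
  have hadd : ∀ A A' B, D (A + A') B = D A B + D A' B := fun A A' B =>
    amplitudes_ext fun t ht => by
      rw [map_add, Submodule.coe_add, hD _ _ t ht, hD _ _ t ht, hD _ _ t ht, waveSource_add_left,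
        duhamel_add α β (continuous_waveSource A B) (continuous_waveSource A' B), Pi.add_apply]
  have hsmul : ∀ (c : ℝ) A B, D (c • A) B = c • D A B := fun c A B =>
    amplitudes_ext fun t ht => by
      rw [map_smul, Submodule.coe_smul, hD _ _ t ht, hD _ _ t ht, waveSource_smul_left,
        duhamel_smul, Pi.smul_apply]
  have hcomm : ∀ A B, D A B = D B A := fun A B =>
    amplitudes_ext fun t ht => by rw [hD _ _ t ht, hD _ _ t ht, waveSource_comm]
  refine ⟨(LinearMap.mk₂ ℝ D hadd hsmul
    (fun A B B' => by simp only [hcomm A, hadd])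
    fun c A B => by simp only [hcomm A, hsmul]).mkContinuous₂ (8 * Real.pi ^ 2)
      fun A B => (hDnorm A B).trans_eq (by ring), hD⟩

/-- The factor `1 / 2` comes from `v v_x = (v²)_x / 2`. -/
theorem exists_picardMap (T : ℝ≥0) (α β : ℝ) :
    ∃ P : amplitudes T × amplitudes T →L[ℝ] amplitudes T × amplitudes T →L[ℝ]
        amplitudes T × amplitudes T, ∀ w z, ∀ t ∈ Icc 0 (T : ℝ),
      (slice t (P w z).1 : ℝ → ℂ) = duhamel 1 0 ((1 / 2 : ℝ) • waveSource w.2 z.2) t ∧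
      (slice t (P w z).2 : ℝ → ℂ) = duhamel α β (waveSource w.1 z.2) t := by
  obtain ⟨D, hD⟩ := exists_duhamel_bilinear (T := T) 1 0
  obtain ⟨D', hD'⟩ := exists_duhamel_bilinear (T := T) α β
  obtain ⟨P, hP⟩ := exists_bilinear_prod (1 / 2) D D'
  refine ⟨P, fun w z t ht => ⟨?_, ?_⟩⟩
  · rw [hP, map_smul, Submodule.coe_smul, hD _ _ t ht, duhamel_smul, Pi.smul_apply]
  · rw [hP, hD' _ _ t ht]

end Amplitudes

section Evolution

variable {f g : ℝ → ℂ}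

variable (α β : ℝ)

theorem ExpDecay.integrable_symbol_mul (hf : ExpDecay f) (n : ℕ) :
    Integrable fun ξ : ℝ => (2 * Real.pi * Complex.I * ξ) ^ n * f ξ := by
  convert (hf.integrable_pow_smul n).const_mul ((2 * Real.pi * Complex.I) ^ n) using 2 with ξ
  rw [Complex.real_smul, Complex.ofReal_pow, mul_pow, mul_assoc]

theorem dispersion_mul_I (ξ : ℝ) : (dispersion α β ξ : ℂ) * Complex.I
    = -α * (2 * Real.pi * Complex.I * ξ) ^ 3 + -β * (2 * Real.pi * Complex.I * ξ) ^ 1 := by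
  simp only [dispersion, mul_pow, Complex.I_pow_three]
  push_cast
  ring

theorem ExpDecay.integrable_dispersion_mul (hf : ExpDecay f) :
    Integrable fun ξ => dispersion α β ξ * Complex.I * f ξ := by
  simp only [dispersion_mul_I, add_mul, mul_assoc (-_ : ℂ)]
  exact ((hf.integrable_symbol_mul 3).const_mul _).add ((hf.integrable_symbol_mul 1).const_mul _)

theorem fourierInv_dispersion_mul (hf : ExpDecay f) (x : ℝ) :
    𝓕⁻ (fun ξ => dispersion α β ξ * Complex.I * f ξ) x
      = -(α * iteratedDeriv 3 (𝓕⁻ f) x) - β * deriv (𝓕⁻ f) x := by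
  have hsum := fourierInv_add_apply ((hf.integrable_symbol_mul 3).const_mul (-α : ℂ))
    ((hf.integrable_symbol_mul 1).const_mul (-β : ℂ)) x
  rw [fourierInv_const_mul, fourierInv_const_mul, ← iteratedDeriv_fourierInv hf,
    ← iteratedDeriv_fourierInv hf, iteratedDeriv_one] at hsum
  simp only [dispersion_mul_I, add_mul, mul_assoc (-_ : ℂ)]
  refine hsum.trans ?_
  ring

/-- The Fourier transform of the solution of `u_t + α u_xxx + β u_x = F` whose initial datum has
Fourier transform `g`. -/
def evolution (g : ℝ → ℂ) (F : ℝ → ℝ → ℂ) (t ξ : ℝ) : ℂ :=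
  propagator α β t ξ * g ξ + duhamel α β F t ξ

variable {F : ℝ → ℝ → ℂ} {M K : ℝ}

theorem evolution_zero (g : ℝ → ℂ) (F : ℝ → ℝ → ℂ) : evolution α β g F 0 = g := by
  ext ξ
  simp [evolution, propagator_zero, duhamel]

theorem continuous_evolution (hg : Continuous g) (hF : Continuous (Function.uncurry F)) (t : ℝ) :
    Continuous (evolution α β g F t) :=
  (((continuous_propagator α β).comp (Continuous.prodMk_right t)).mul hg).add
    ((continuous_duhamel α β hF).comp (Continuous.prodMk_right t))

theorem norm_evolution_le (hg : ∀ ξ, ‖g ξ‖ ≤ M * Real.exp (-|ξ|))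
    (hF : ∀ t ξ, ‖F t ξ‖ ≤ K * Real.exp (-|ξ|)) (t ξ : ℝ) :
    ‖evolution α β g F t ξ‖ ≤ (M + K * |t|) * Real.exp (-|ξ|) := calc
  _ ≤ M * Real.exp (-|ξ|) + K * Real.exp (-|ξ|) * |t| := by
    refine (norm_add_le _ _).trans (add_le_add ?_ (norm_duhamel_le_of_norm_le α β (hF · ξ) t))
    rw [norm_mul, norm_propagator, one_mul]
    exact hg ξ
  _ = _ := by ring

theorem hasDerivAt_evolution (g : ℝ → ℂ) (hF : Continuous (Function.uncurry F)) (t ξ : ℝ) :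
    HasDerivAt (fun t => evolution α β g F t ξ)
      (dispersion α β ξ * Complex.I * evolution α β g F t ξ + F t ξ) t :=
  (((hasDerivAt_propagator α β t ξ).mul_const (g ξ)).add
    (hasDerivAt_duhamel α β hF t ξ)).congr_deriv (by rw [evolution]; ring)

theorem hasDerivAt_fourierInv_evolution (hg : ExpDecay g) (hF : Continuous (Function.uncurry F))
    (hFK : ∀ t ξ, ‖F t ξ‖ ≤ K * Real.exp (-|ξ|)) (t x : ℝ) :
    HasDerivAt (fun t => 𝓕⁻ (evolution α β g F t) x)
      (-(α * iteratedDeriv 3 (𝓕⁻ (evolution α β g F t)) x)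
        - β * deriv (𝓕⁻ (evolution α β g F t)) x + 𝓕⁻ (F t) x) t := by
  obtain ⟨M, hM⟩ := hg.exists_norm_le
  have hK : 0 ≤ K := by simpa using (norm_nonneg _).trans (hFK 0 0)
  have hFt : ∀ t, Continuous (F t) := fun t => hF.comp (Continuous.prodMk_right t)
  have hdecay : ∀ t, ExpDecay (evolution α β g F t) := fun t =>
    .of_norm_le (continuous_evolution α β hg.continuous hF t) (norm_evolution_le α β hM hFK t)
  have hnorm : ∀ ξ : ℝ, ‖(Real.exp (-|ξ|) : ℂ)‖ = Real.exp (-|ξ|) := fun ξ => by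
    rw [Complex.norm_real, Real.norm_of_nonneg (Real.exp_pos _).le]
  have hexp : ExpDecay fun ξ => (Real.exp (-|ξ|) : ℂ) :=
    .of_norm_le (M := 1) (by fun_prop) fun ξ => by rw [hnorm, one_mul]
  have hbound : ∀ τ ∈ Metric.ball t 1, ∀ ξ,
      ‖dispersion α β ξ * Complex.I * evolution α β g F τ ξ + F τ ξ‖
        ≤ (M + K * (|t| + 1)) * ‖dispersion α β ξ * Complex.I * (Real.exp (-|ξ|) : ℂ)‖
          + K * ‖(Real.exp (-|ξ|) : ℂ)‖ := fun τ hτ ξ => by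
    have hτt : |τ| ≤ |t| + 1 := by
      have := abs_sub_abs_le_abs_sub τ t
      linarith [mem_ball_iff_norm.mp hτ, Real.norm_eq_abs (τ - t)]
    refine (norm_add_le _ _).trans (add_le_add ?_ ((hFK τ ξ).trans_eq (by rw [hnorm])))
    rw [norm_mul, norm_mul _ (Real.exp _ : ℂ), hnorm, mul_left_comm]
    refine mul_le_mul_of_nonneg_left ((norm_evolution_le α β hM hFK τ ξ).trans ?_) (norm_nonneg _)
    gcongr
  have hsplit := fourierInv_add_apply ((hdecay t).integrable_dispersion_mul α β)
    (ExpDecay.of_norm_le (hFt t) (hFK t)).integrable x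
  rw [fourierInv_dispersion_mul α β (hdecay t)] at hsplit
  rw [← hsplit]
  refine hasDerivAt_fourierInv (Metric.ball_mem_nhds t one_pos) (fun τ => (hdecay τ).continuous)
    (hdecay t).integrable ?_ ?_ hbound (fun τ _ ξ => hasDerivAt_evolution α β g hF τ ξ) x
  · have := (hdecay t).continuous
    have := hFt t
    unfold dispersion
    fun_prop
  · exact ((hexp.integrable_dispersion_mul α β).norm.const_mul _).add
      (hexp.integrable.norm.const_mul _)

end Evolution

section Solutions

open scoped NNReal

variable {𝔽 : Subalgebra ℝ ℂ} {σ : ℝ}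

theorem rpow_mul_norm_sq_le {z : ℂ} {M ξ : ℝ} (hz : ‖z‖ ≤ M * Real.exp (-|ξ|)) (σ : ℝ) :
    (1 + ξ ^ 2) ^ σ * ‖z‖ ^ 2 ≤ M ^ 2 * ((1 + ξ ^ 2) ^ σ * Real.exp (-|ξ|)) := by
  have hexp : Real.exp (-|ξ|) ^ 2 ≤ Real.exp (-|ξ|) :=
    pow_le_of_le_one (Real.exp_pos _).le (by simp) two_ne_zero
  calc (1 + ξ ^ 2) ^ σ * ‖z‖ ^ 2 ≤ (1 + ξ ^ 2) ^ σ * (M * Real.exp (-|ξ|)) ^ 2 := by gcongr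
    _ = M ^ 2 * ((1 + ξ ^ 2) ^ σ * Real.exp (-|ξ|) ^ 2) := by ring
    _ ≤ _ := by gcongr

theorem norm_ofFourier_le {g : fourierData} {M : ℝ} (hM : ∀ ξ, ‖g ξ‖ ≤ M * Real.exp (-|ξ|)) :
    ‖ofFourier 𝔽 σ g‖ ≤ √(∫ ξ : ℝ, (1 + ξ ^ 2) ^ σ * Real.exp (-|ξ|)) * M := by
  have hM0 : 0 ≤ M := by simpa using (norm_nonneg _).trans (hM 0)
  refine le_of_sq_le_sq ?_ (by positivity)
  rw [norm_ofFourier_sq, mul_pow, Real.sq_sqrt (integral_nonneg fun ξ => by positivity), mul_comm,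
    ← integral_const_mul]
  exact integral_mono_of_nonneg (Eventually.of_forall fun ξ => by positivity)
    ((integrable_rpow_mul_exp σ).const_mul _)
    (Eventually.of_forall fun ξ => rpow_mul_norm_sq_le (hM ξ) σ)

theorem continuous_ofFourier {X : Type*} [TopologicalSpace X] [FirstCountableTopology X]
    {g : X → fourierData} {M : ℝ} (hg : ∀ ξ, Continuous fun x => g x ξ)
    (hM : ∀ x ξ, ‖g x ξ‖ ≤ M * Real.exp (-|ξ|)) : Continuous fun x => ofFourier 𝔽 σ (g x) := by
  refine continuous_iff_continuousAt.mpr fun x₀ => ?_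
  rw [ContinuousAt, tendsto_iff_norm_sub_tendsto_zero]
  have hdist : ∀ x, ‖ofFourier 𝔽 σ (g x) - ofFourier 𝔽 σ (g x₀)‖
      = √(∫ ξ, (1 + ξ ^ 2) ^ σ * ‖g x ξ - g x₀ ξ‖ ^ 2) := fun x => by
    rw [← map_sub, ← Real.sqrt_sq (norm_nonneg _), norm_ofFourier_sq]
    rfl
  have hcont : Continuous fun x => √(∫ ξ, (1 + ξ ^ 2) ^ σ * ‖g x ξ - g x₀ ξ‖ ^ 2) := by
    refine Real.continuous_sqrt.comp (continuous_of_dominated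
      (bound := fun ξ => (M + M) ^ 2 * ((1 + ξ ^ 2) ^ σ * Real.exp (-|ξ|))) (fun x => ?_)
      (fun x => Eventually.of_forall fun ξ => ?_) ((integrable_rpow_mul_exp σ).const_mul _)
      (Eventually.of_forall fun ξ => continuous_const.mul
        (((hg ξ).sub continuous_const).norm.pow 2)))
    · exact ((continuous_one_add_sq_rpow σ).mul
        (((g x).2.1.continuous.sub (g x₀).2.1.continuous).norm.pow 2)).aestronglyMeasurable
    · rw [Real.norm_of_nonneg (by positivity)]
      refine rpow_mul_norm_sq_le ((norm_sub_le _ _).trans ?_) σ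
      linarith [hM x ξ, hM x₀ ξ]
  simp only [hdist]
  simpa using hcont.tendsto x₀

variable {T : ℝ≥0}

theorem continuous_ofFourier_slice (A : amplitudes T) :
    Continuous fun t => ofFourier 𝔽 σ (slice t A) := by
  have hcont : ∀ ξ, Continuous fun t => slice t A ξ := fun ξ => by
    simpa only [Function.comp_def] using (continuous_slice A).comp (Continuous.prodMk_left ξ)
  exact continuous_ofFourier hcont fun t ξ => norm_slice_le_exp t A ξ

/-- The path in `H^σ × H^σ` of the pair of waves with given amplitudes. -/
def pathMap (𝔽 : Subalgebra ℝ ℂ) (σ : ℝ) :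
    amplitudes T × amplitudes T →L[ℝ] PathSpace 𝔽 σ T :=
  LinearMap.mkContinuous
    { toFun := fun w =>
        ⟨fun t => (ofFourier 𝔽 σ (slice t w.1), ofFourier 𝔽 σ (slice t w.2)),
          ((continuous_ofFourier_slice w.1).comp continuous_subtype_val).prodMk
            ((continuous_ofFourier_slice w.2).comp continuous_subtype_val)⟩
      map_add' := fun w z => by ext t <;> simp
      map_smul' := fun c w => by ext t <;> simp }
    √(∫ ξ : ℝ, (1 + ξ ^ 2) ^ σ * Real.exp (-|ξ|)) fun w => by
      refine (ContinuousMap.norm_le _ (by positivity)).mpr fun t => max_le ?_ ?_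
      · exact (norm_ofFourier_le (norm_slice_le_exp _ w.1)).trans
          (mul_le_mul_of_nonneg_left (norm_fst_le w) (Real.sqrt_nonneg _))
      · exact (norm_ofFourier_le (norm_slice_le_exp _ w.2)).trans
          (mul_le_mul_of_nonneg_left (norm_snd_le w) (Real.sqrt_nonneg _))

theorem pathMap_apply (w : amplitudes T × amplitudes T) (t : Icc (0 : ℝ) T) :
    pathMap 𝔽 σ w t = (ofFourier 𝔽 σ (slice t w.1), ofFourier 𝔽 σ (slice t w.2)) := rfl

theorem pathIsGivenBy_pathMap (w : amplitudes T × amplitudes T) :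
    PathIsGivenBy (pathMap 𝔽 σ w) (fun t => 𝓕⁻ (slice t w.1 : ℝ → ℂ))
      (fun t => 𝓕⁻ (slice t w.2 : ℝ → ℂ)) :=
  fun t => ⟨isGivenBy_ofFourier (slice t w.1), isGivenBy_ofFourier (slice t w.2)⟩

theorem hasDerivWithinAt_fourierInv_slice (α β : ℝ) {A : amplitudes T} {g : ℝ → ℂ}
    {F : ℝ → ℝ → ℂ} {K : ℝ} (hg : ExpDecay g) (hF : Continuous (Function.uncurry F))
    (hFK : ∀ t ξ, ‖F t ξ‖ ≤ K * Real.exp (-|ξ|))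
    (hA : ∀ t ∈ Icc 0 (T : ℝ), (slice t A : ℝ → ℂ) = evolution α β g F t) {t : ℝ}
    (ht : t ∈ Icc 0 (T : ℝ)) (x : ℝ) :
    HasDerivWithinAt (fun t => 𝓕⁻ (slice t A : ℝ → ℂ) x)
      (-(α * iteratedDeriv 3 (𝓕⁻ (slice t A : ℝ → ℂ)) x)
        - β * deriv (𝓕⁻ (slice t A : ℝ → ℂ)) x + 𝓕⁻ (F t) x) (Icc 0 T) t := by
  have hderiv := (hasDerivAt_fourierInv_evolution α β hg hF hFK t x).hasDerivWithinAt
    (s := Icc 0 (T : ℝ))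
  rw [← hA t ht] at hderiv
  exact hderiv.congr (fun τ hτ => by rw [hA τ hτ]) (by rw [hA t ht])

theorem deriv_fourierInv_slice_mul_self (A : amplitudes T) (t x : ℝ) :
    deriv (fun y => 𝓕⁻ (slice t A : ℝ → ℂ) y * 𝓕⁻ (slice t A : ℝ → ℂ) y) x
      = 2 * (𝓕⁻ (slice t A : ℝ → ℂ) x * deriv (𝓕⁻ (slice t A : ℝ → ℂ)) x) := by
  have hdiff : DifferentiableAt ℝ (𝓕⁻ (slice t A : ℝ → ℂ)) x :=
    (contDiff_fourierInv (slice t A).2.1).contDiffAt.differentiableAt (by simp)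
  rw [deriv_fun_mul hdiff hdiff]
  ring

theorem isSmoothSolution_slice {α β : ℝ} {w : amplitudes T × amplitudes T} {g₁ g₂ : ℝ → ℂ}
    (hg₁ : ExpDecay g₁) (hg₂ : ExpDecay g₂)
    (hw₁ : ∀ t ∈ Icc 0 (T : ℝ),
      (slice t w.1 : ℝ → ℂ) = evolution 1 0 g₁ ((1 / 2 : ℝ) • waveSource w.2 w.2) t)
    (hw₂ : ∀ t ∈ Icc 0 (T : ℝ),
      (slice t w.2 : ℝ → ℂ) = evolution α β g₂ (waveSource w.1 w.2) t) :
    IsSmoothSolution 𝔽 α β T (fun t => 𝓕⁻ (slice t w.1 : ℝ → ℂ))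
      (fun t => 𝓕⁻ (slice t w.2 : ℝ → ℂ)) where
  smooth_u t _ := contDiff_fourierInv (slice t w.1).2.1
  smooth_v t _ := contDiff_fourierInv (slice t w.2).2.1
  continuous_sobolev σ := ⟨pathMap 𝔽 σ w, pathIsGivenBy_pathMap w⟩
  eq_u t ht x := by
    have hcont : Continuous (Function.uncurry ((1 / 2 : ℝ) • waveSource w.2 w.2)) :=
      (continuous_waveSource w.2 w.2).const_smul (1 / 2 : ℝ)
    refine (hasDerivWithinAt_fourierInv_slice 1 0 hg₁ hcont
      (K := 8 * Real.pi ^ 2 * (‖w.2‖ * ‖w.2‖)) (fun τ ξ => ?_) hw₁ ht x).congr_deriv ?_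
    · rw [Pi.smul_apply, Pi.smul_apply, norm_smul]
      exact (mul_le_of_le_one_left (norm_nonneg _) (by norm_num)).trans
        (norm_waveSource_le_exp w.2 w.2 τ ξ)
    · have hhalf : 𝓕⁻ (((1 / 2 : ℝ) • waveSource w.2 w.2) t) x
          = (1 / 2 : ℂ) * 𝓕⁻ (waveSource w.2 w.2 t) x := by
        rw [← fourierInv_const_mul]
        exact congrArg (fun f : ℝ → ℂ => 𝓕⁻ f x) (funext fun ξ => by simp)
      rw [hhalf, fourierInv_waveSource, deriv_fourierInv_slice_mul_self]
      push_cast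
      ring
  eq_v t ht x := by
    refine (hasDerivWithinAt_fourierInv_slice α β hg₂ (continuous_waveSource w.1 w.2)
      (norm_waveSource_le_exp w.1 w.2) hw₂ ht x).congr_deriv ?_
    rw [fourierInv_waveSource, ← sub_eq_add_neg]

theorem isSolution_pathMap {α β : ℝ} {w : amplitudes T × amplitudes T} {g₁ g₂ : ℝ → ℂ}
    (hg₁ : ExpDecay g₁) (hg₂ : ExpDecay g₂)
    (hw₁ : ∀ t ∈ Icc 0 (T : ℝ),
      (slice t w.1 : ℝ → ℂ) = evolution 1 0 g₁ ((1 / 2 : ℝ) • waveSource w.2 w.2) t)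
    (hw₂ : ∀ t ∈ Icc 0 (T : ℝ),
      (slice t w.2 : ℝ → ℂ) = evolution α β g₂ (waveSource w.1 w.2) t) :
    IsSolution α β (pathMap 𝔽 σ w) :=
  subset_closure ⟨_, _, isSmoothSolution_slice hg₁ hg₂ hw₁ hw₂, pathIsGivenBy_pathMap w⟩

end Solutions

section SecondIterate

open scoped NNReal

variable {α β : ℝ}

/-- The Fourier transform of the solution of `v_t + α v_xxx + β v_x = 0` whose initial datum has
Fourier transform `g`. -/
def freeWave (α β : ℝ) (g : ℝ → ℂ) (t ξ : ℝ) : ℂ := propagator α β t ξ * g ξ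

/-- The Fourier transform of the first component of the second Picard iterate of the data whose
Fourier transform is `(0, g)`. -/
def secondIterate (α β : ℝ) (g : ℝ → ℂ) : ℝ → ℝ → ℂ :=
  duhamel 1 0 ((1 / 2 : ℝ) • fun τ => source (freeWave α β g τ) (freeWave α β g τ))

theorem continuous_freeWave (α β : ℝ) {g : ℝ → ℂ} (hg : Continuous g) :
    Continuous (Function.uncurry (freeWave α β g)) :=
  (continuous_propagator α β).mul (hg.comp continuous_snd)

theorem norm_freeWave (α β : ℝ) (g : ℝ → ℂ) (t ξ : ℝ) : ‖freeWave α β g t ξ‖ = ‖g ξ‖ := by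
  rw [freeWave, norm_mul, norm_propagator, one_mul]

theorem ExpDecay.freeWave {g : ℝ → ℂ} (hg : ExpDecay g) (α β t : ℝ) :
    ExpDecay (freeWave α β g t) where
  continuous := (continuous_freeWave α β hg.continuous).comp (Continuous.prodMk_right t)
  isBigO := (isBigO_of_le _ fun ξ => (norm_freeWave α β g t ξ).le).trans hg.isBigO

theorem continuous_source_freeWave (α β : ℝ) {g : ℝ → ℂ} (hg : ExpDecay g) :
    Continuous (Function.uncurry fun t => source (freeWave α β g t) (freeWave α β g t)) := by
  have hcont := continuous_freeWave α β hg.continuous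
  obtain ⟨M, hM⟩ := hg.exists_norm_le
  have hM0 : 0 ≤ M := by simpa using (norm_nonneg _).trans (hM 0)
  have hsymbol : Continuous fun p : ℝ × ℝ => -(2 * Real.pi * p.2 * Complex.I) := by fun_prop
  refine hsymbol.mul (continuous_convolution_of_norm_le (N := M) hcont hcont hg.integrable.norm
    (fun t η => (norm_freeWave α β g t η).le) fun t ξ => ?_)
  rw [norm_freeWave]
  exact (hM ξ).trans (mul_le_of_le_one_right hM0 (Real.exp_le_one_iff.mpr (by simp)))

theorem exists_norm_le_expWeight (r : ℝ) {g : ℝ → ℂ} (hg : Continuous g)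
    (hsupp : HasCompactSupport g) : ∃ M, 0 ≤ M ∧ ∀ ξ, ‖g ξ‖ ≤ M * expWeight r ξ := by
  have hweight : Continuous fun ξ => ((expWeight r ξ : ℝ) : ℂ) := Complex.continuous_ofReal.comp
    (continuous_expWeight.comp (Continuous.prodMk_right r))
  have hquot : Continuous fun ξ => g ξ * ((expWeight r ξ : ℝ) : ℂ)⁻¹ :=
    hg.mul (hweight.inv₀ fun ξ => Complex.ofReal_ne_zero.mpr (expWeight_pos r ξ).ne')
  obtain ⟨M, hM⟩ := hsupp.mul_right.exists_bound_of_continuous hquot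
  refine ⟨M, (norm_nonneg _).trans (hM 0), fun ξ => ?_⟩
  have hpos := expWeight_pos r ξ
  have hξ := hM ξ
  rwa [Pi.mul_apply, norm_mul, norm_inv, Complex.norm_real, Real.norm_of_nonneg hpos.le,
    ← div_eq_mul_inv, div_le_iff₀ hpos] at hξ

theorem ExpDecay.of_hasCompactSupport {g : ℝ → ℂ} (hg : Continuous g)
    (hsupp : HasCompactSupport g) : ExpDecay g := by
  obtain ⟨M, hM0, hM⟩ := exists_norm_le_expWeight 1 hg hsupp
  exact ExpDecay.of_norm_le hg fun ξ =>
    (hM ξ).trans (mul_le_mul_of_nonneg_left (expWeight_one_le ξ) hM0)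

variable {T : ℝ≥0}

theorem exists_amplitude_freeWave (T : ℝ≥0) (α β : ℝ) (g : fourierData)
    (hsupp : HasCompactSupport g) :
    ∃ A : amplitudes T, ∀ t ∈ Icc 0 (T : ℝ), (slice t A : ℝ → ℂ) = freeWave α β g t := by
  obtain ⟨M, hM0, hM⟩ := exists_norm_le_expWeight (1 + T) g.2.1.continuous hsupp
  obtain ⟨A, -, hA⟩ := exists_amplitude (T := T) hM0 (continuous_freeWave α β g.2.1.continuous)
    (fun t ξ => by simp only [freeWave, propagator_neg, g.2.2 ξ, map_mul]) fun t ht ξ => by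
      rw [norm_freeWave]
      exact (hM ξ).trans
        (mul_le_mul_of_nonneg_left (expWeight_anti ξ (sub_le_self _ ht.1)) hM0)
  exact ⟨A, hA⟩

theorem duhamel_congr {F G : ℝ → ℝ → ℂ} {t : ℝ} (h : ∀ τ ∈ Icc 0 t, F τ = G τ) (ht : 0 ≤ t) :
    duhamel α β F t = duhamel α β G t := by
  ext ξ
  refine intervalIntegral.integral_congr fun τ hτ => ?_
  rw [uIcc_of_le ht] at hτ
  simp only [h τ hτ]

theorem duhamel_waveSource_eq_secondIterate {A : amplitudes T} {g : ℝ → ℂ}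
    (hA : ∀ t ∈ Icc 0 (T : ℝ), (slice t A : ℝ → ℂ) = freeWave α β g t) {t : ℝ}
    (ht : t ∈ Icc 0 (T : ℝ)) :
    duhamel 1 0 ((1 / 2 : ℝ) • waveSource A A) t = secondIterate α β g t := by
  refine duhamel_congr (fun τ hτ => ?_) ht.1
  ext ξ
  simp only [Pi.smul_apply, waveSource, hA τ ⟨hτ.1, hτ.2.trans ht.2⟩]

theorem secondIterate_mem_fourierData (α β : ℝ) (g : fourierData) (hsupp : HasCompactSupport g)
    (T : ℝ≥0) : secondIterate α β g T ∈ fourierData := by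
  obtain ⟨A, hA⟩ := exists_amplitude_freeWave T α β g hsupp
  obtain ⟨P, hP⟩ := exists_picardMap T α β
  have hT : (T : ℝ) ∈ Icc 0 (T : ℝ) := ⟨T.coe_nonneg, le_rfl⟩
  rw [← duhamel_waveSource_eq_secondIterate hA hT, ← (hP (0, A) (0, A) T hT).1]
  exact (slice (T : ℝ) _).2

theorem exists_solution_expansion (α β : ℝ) {A : amplitudes T} {g : ℝ → ℂ}
    (hA : ∀ t ∈ Icc 0 (T : ℝ), (slice t A : ℝ → ℂ) = freeWave α β g t) :
    ∃ (z : amplitudes T × amplitudes T) (w : ℝ → amplitudes T × amplitudes T),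
      (∀ t ∈ Icc 0 (T : ℝ), (slice t z.1 : ℝ → ℂ) = secondIterate α β g t) ∧
      (∀ᶠ ε in 𝓝 0, ∀ t ∈ Icc 0 (T : ℝ),
        (slice t (w ε).1 : ℝ → ℂ)
          = evolution 1 0 0 ((1 / 2 : ℝ) • waveSource (w ε).2 (w ε).2) t ∧
        (slice t (w ε).2 : ℝ → ℂ) = evolution α β (ε • g) (waveSource (w ε).1 (w ε).2) t) ∧
      (fun ε : ℝ => w ε - (ε • (0, A) + ε ^ 2 • z)) =o[𝓝 0] fun ε : ℝ => ε ^ 2 := by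
  obtain ⟨P, hP⟩ := exists_picardMap T α β
  obtain ⟨W, hW, hexp⟩ := exists_quadratic_fixedPoint P
  let l : amplitudes T × amplitudes T := (0, A)
  have hlim : Tendsto (fun ε : ℝ => ε • l) (𝓝 0) (𝓝 0) :=
    (continuous_id.smul continuous_const).tendsto' 0 0 (zero_smul ℝ l)
  refine ⟨P l l, fun ε => W (ε • l), fun t ht => ?_, ?_, ?_⟩
  · rw [(hP l l t ht).1]
    exact duhamel_waveSource_eq_secondIterate hA ht
  · filter_upwards [hlim.eventually hW] with ε hε t ht
    have hPt := hP (W (ε • l)) (W (ε • l)) t ht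
    have hsum : ∀ {A A₁ A₂ : amplitudes T}, A = A₁ + A₂ →
        (slice t A : ℝ → ℂ) = (slice t A₁ : ℝ → ℂ) + slice t A₂ := by rintro _ A₁ A₂ rfl; simp
    constructor
    · rw [hsum (congrArg Prod.fst hε), hPt.1]
      ext ξ
      simp [evolution, l]
    · rw [hsum (congrArg Prod.snd hε), hPt.2]
      ext ξ
      simp [evolution, l, hA t ht, freeWave]
      ring
  · have hcubic : (fun ε : ℝ => W (ε • l) - (ε • l + ε ^ 2 • P l l)) =O[𝓝 0] fun ε => ε ^ 3 := by
      refine ((hexp.comp_tendsto hlim).congr_left fun ε => ?_).trans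
        (IsBigO.of_bound (‖l‖ ^ 3) (Eventually.of_forall fun ε => ?_))
      · simp [smul_smul, sub_sub, sq]
      · simp [norm_smul, mul_pow, mul_comm]
    exact hcubic.trans_isLittleO (isLittleO_pow_pow (by norm_num))

/-- For a `C²` flow map, the second Picard iterate is the second-order term in `ε` of the solution
with data `ε (0, g)`, and hence quadratically bounded. -/
theorem IsLocallyWellPosed.exists_norm_ofFourier_secondIterate_le {𝔽 : Subalgebra ℝ ℂ} {s : ℝ}
    (h : IsLocallyWellPosed 2 𝔽 α β s) :
    ∃ (T : ℝ≥0) (C : ℝ), 0 < T ∧ ∀ g q : fourierData, HasCompactSupport g →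
      (q : ℝ → ℂ) = secondIterate α β g T →
      ‖ofFourier 𝔽 s q‖ ≤ C * ‖ofFourier 𝔽 s g‖ ^ 2 := by
  obtain ⟨T, hT, U, Φ, hU, h0, hsol, hΦ⟩ := h 0
  lift T to ℝ≥0 using hT.le
  obtain ⟨C, hC⟩ := exists_norm_secondOrder_le (hΦ.contDiffAt (hU.mem_nhds h0))
  refine ⟨T, C, by exact_mod_cast hT, fun g q hsupp hq => ?_⟩
  obtain ⟨A, hA⟩ := exists_amplitude_freeWave T α β g hsupp
  obtain ⟨z, w, hz, hw, hexp⟩ := exists_solution_expansion α β hA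
  let f : DataSpace 𝔽 s := (0, ofFourier 𝔽 s g)
  have hsmall : ∀ᶠ ε : ℝ in 𝓝 0, ε • f ∈ U :=
    ((continuous_id.smul continuous_const).tendsto' 0 0 (zero_smul ℝ f)).eventually
      (hU.mem_nhds h0)
  have hflow : ∀ᶠ ε : ℝ in 𝓝 0, Φ (ε • f) = pathMap 𝔽 s (w ε) := by
    filter_upwards [hsmall, hw] with ε hε hwε
    have hslice := hwε 0 ⟨le_rfl, hT.le⟩
    rw [evolution_zero, evolution_zero] at hslice
    refine ((hsol _ hε).2.2 (pathMap 𝔽 s (w ε)) (isSolution_pathMap fourierData.zero_mem.1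
      (ε • g).2.1 (fun t ht => (hwε t ht).1) fun t ht => (hwε t ht).2) ?_).symm
    rw [pathMap_apply, show slice (0 : ℝ) (w ε).1 = 0 from Subtype.ext hslice.1,
      show slice (0 : ℝ) (w ε).2 = ε • g from Subtype.ext hslice.2]
    simp [f]
  have hbound : ‖pathMap 𝔽 s z‖ ≤ C * ‖f‖ ^ 2 := by
    refine hC f 0 (pathMap 𝔽 s (0, A)) _ ((((pathMap 𝔽 s).isBigO_comp _ _).trans_isLittleO
      hexp).congr' ?_ EventuallyEq.rfl)
    filter_upwards [hflow] with ε hε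
    simp only [zero_add, hε, map_sub, map_add, map_smul]
  have hTmem : (T : ℝ) ∈ Icc 0 (T : ℝ) := ⟨hT.le, le_rfl⟩
  have hq' : q = slice (T : ℝ) z.1 := Subtype.ext (hq.trans (hz T hTmem).symm)
  calc ‖ofFourier 𝔽 s q‖ = ‖(pathMap 𝔽 s z ⟨T, hTmem⟩).1‖ := by rw [hq', pathMap_apply]
    _ ≤ ‖pathMap 𝔽 s z‖ := (norm_fst_le _).trans ((pathMap 𝔽 s z).norm_coe_le_norm _)
    _ ≤ C * ‖f‖ ^ 2 := hbound
    _ = _ := by simp [f, Prod.norm_def]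

end SecondIterate

section Resonance

theorem dispersion_resonance (ξ η : ℝ) :
    dispersion 4 0 η + dispersion 4 0 (ξ - η) - dispersion 1 0 ξ
      = (2 * Real.pi) ^ 3 * (3 * ξ * (ξ - 2 * η) ^ 2) := by
  unfold dispersion
  ring

theorem propagator_mul_freeWave_mul_freeWave (p : ℝ → ℝ) (τ ξ η : ℝ) :
    propagator 1 0 (-τ) ξ
        * (freeWave 4 0 (fun ξ => p ξ) τ η * freeWave 4 0 (fun ξ => p ξ) τ (ξ - η))
      = ((p η * p (ξ - η) : ℝ) : ℂ)
        * Complex.exp ((τ * ((2 * Real.pi) ^ 3 * (3 * ξ * (ξ - 2 * η) ^ 2)) : ℝ) * Complex.I) := by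
  have hphase : propagator 1 0 (-τ) ξ * (propagator 4 0 τ η * propagator 4 0 τ (ξ - η))
      = Complex.exp ((τ * ((2 * Real.pi) ^ 3 * (3 * ξ * (ξ - 2 * η) ^ 2)) : ℝ) * Complex.I) := by
    rw [← dispersion_resonance]
    simp only [propagator, ← Complex.exp_add]
    congr 1
    push_cast
    ring
  rw [← hphase, freeWave, freeWave]
  push_cast
  ring

theorem mul_le_norm_integral {T m : ℝ} {f : ℝ → ℂ} {z : ℂ} (hT : 0 ≤ T) (hz : ‖z‖ = 1)
    (hf : IntervalIntegrable f volume 0 T) (hm : ∀ τ ∈ Icc 0 T, m ≤ (z * f τ).re) :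
    T * m ≤ ‖∫ τ in 0..T, f τ‖ := by
  have hzf := hf.const_mul z
  calc T * m = ∫ _ in 0..T, m := by simp
    _ ≤ ∫ τ in 0..T, (z * f τ).re :=
      intervalIntegral.integral_mono_on hT intervalIntegrable_const ⟨hzf.1.re, hzf.2.re⟩ hm
    _ = (z * ∫ τ in 0..T, f τ).re := by
      rw [← intervalIntegral.integral_const_mul]
      exact Complex.reCLM.intervalIntegral_comp_comm hzf
    _ ≤ ‖∫ τ in 0..T, f τ‖ := (Complex.re_le_norm _).trans_eq (by rw [norm_mul, hz, one_mul])

end Resonance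

section Peaks

/-- An even trapezoidal profile, equal to `1` within distance `δ` of `±N` and to `0` beyond distance
`2 * δ`: the Fourier transform of the initial datum of the counterexample. -/
def peaks (N δ ξ : ℝ) : ℝ := max 0 (min 1 (2 - |(|ξ| - N)| / δ))

variable {N δ ξ η : ℝ}

theorem peaks_nonneg (N δ ξ : ℝ) : 0 ≤ peaks N δ ξ := le_max_left _ _

theorem peaks_le_one (N δ ξ : ℝ) : peaks N δ ξ ≤ 1 := max_le zero_le_one (min_le_left _ _)

theorem peaks_eq_one (hδ : 0 < δ) (hδN : δ ≤ N) (h : |ξ - N| ≤ δ) : peaks N δ ξ = 1 := by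
  have hξ : 0 ≤ ξ := by linarith [(abs_le.mp h).1]
  have hquot : |ξ - N| / δ ≤ 1 := (div_le_one hδ).mpr h
  rw [peaks, abs_of_nonneg hξ, min_eq_left (by linarith), max_eq_right zero_le_one]

theorem abs_lt_of_peaks_ne_zero (hδ : 0 < δ) (h : peaks N δ ξ ≠ 0) : |(|ξ| - N)| < 2 * δ := by
  contrapose! h
  have hquot : 2 ≤ |(|ξ| - N)| / δ := (le_div_iff₀ hδ).mpr h
  exact max_eq_left ((min_le_right _ _).trans (by linarith))

theorem continuous_peaks (N δ : ℝ) : Continuous (peaks N δ) := by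
  unfold peaks
  fun_prop

theorem hasCompactSupport_peaks (N : ℝ) (hδ : 0 < δ) : HasCompactSupport (peaks N δ) := by
  refine HasCompactSupport.intro (isCompact_Icc (a := -(N + 2 * δ)) (b := N + 2 * δ)) fun ξ hξ => ?_
  contrapose! hξ
  refine abs_le.mp ?_
  linarith [(abs_lt.mp (abs_lt_of_peaks_ne_zero hδ hξ)).2]

theorem hasCompactSupport_ofReal_peaks (N : ℝ) (hδ : 0 < δ) :
    HasCompactSupport fun ξ => (peaks N δ ξ : ℂ) :=
  (hasCompactSupport_peaks N hδ).comp_left Complex.ofReal_zero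

theorem peaks_mem_fourierData (N : ℝ) (hδ : 0 < δ) :
    (fun ξ => (peaks N δ ξ : ℂ)) ∈ fourierData :=
  ⟨.of_hasCompactSupport (Complex.continuous_ofReal.comp (continuous_peaks N δ))
    (hasCompactSupport_ofReal_peaks N hδ), fun ξ => by simp [peaks]⟩

theorem integrable_peaks_mul (N : ℝ) (hδ : 0 < δ) (ξ : ℝ) :
    Integrable fun η => peaks N δ η * peaks N δ (ξ - η) :=
  ((continuous_peaks N δ).mul
    ((continuous_peaks N δ).comp (continuous_sub_left ξ))).integrable_of_hasCompactSupport
    (hasCompactSupport_peaks N hδ).mul_right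

theorem le_integral_peaks_mul (hδ : 0 < δ) (hδN : δ ≤ N) (hξ : |ξ - 2 * N| ≤ δ) :
    δ ≤ ∫ η, peaks N δ η * peaks N δ (ξ - η) := by
  rw [abs_le] at hξ
  have hone : ∀ η ∈ Icc (ξ / 2 - δ / 2) (ξ / 2 + δ / 2),
      1 ≤ peaks N δ η * peaks N δ (ξ - η) := fun η hη => by
    rw [mem_Icc] at hη
    rw [peaks_eq_one hδ hδN, peaks_eq_one hδ hδN, one_mul]
    all_goals
      rw [abs_le]
      constructor <;> linarith
  calc δ = ∫ _ in Icc (ξ / 2 - δ / 2) (ξ / 2 + δ / 2), (1 : ℝ) := by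
        rw [setIntegral_const, Real.volume_real_Icc_of_le (by linarith), smul_eq_mul]
        ring
    _ ≤ ∫ η in Icc (ξ / 2 - δ / 2) (ξ / 2 + δ / 2), peaks N δ η * peaks N δ (ξ - η) :=
      setIntegral_mono_on (integrableOn_const (by simp)) (integrable_peaks_mul N hδ ξ).integrableOn
        measurableSet_Icc hone
    _ ≤ _ := setIntegral_le_integral (integrable_peaks_mul N hδ ξ)
      (Eventually.of_forall fun η => mul_nonneg (peaks_nonneg _ _ _) (peaks_nonneg _ _ _))

theorem abs_sub_two_mul_lt (hN : 1 ≤ N) (hδ : 0 < δ) (hδ' : δ ≤ 1 / 4) (hξ : |ξ - 2 * N| ≤ δ)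
    (h : peaks N δ η * peaks N δ (ξ - η) ≠ 0) : |ξ - 2 * η| < 4 * δ := by
  have hη := abs_lt.mp (abs_lt_of_peaks_ne_zero hδ (left_ne_zero_of_mul h))
  have hξη := abs_lt.mp (abs_lt_of_peaks_ne_zero hδ (right_ne_zero_of_mul h))
  rw [abs_le] at hξ
  rw [abs_of_nonneg (by linarith [le_abs_self (ξ - η)])] at hη
  rw [abs_of_nonneg (by linarith)] at hξη
  rw [abs_lt]
  constructor <;> linarith

theorem half_le_cos {T τ : ℝ} (hN : 1 ≤ N) (hδ' : δ ≤ 1 / 4)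
    (hphase : 144 * (2 * Real.pi) ^ 3 * T * (N * δ ^ 2) ≤ 1) (hτ : τ ∈ Icc 0 T)
    (hξ : |ξ - 2 * N| ≤ δ) (h : |ξ - 2 * η| < 4 * δ) :
    1 / 2 ≤ Real.cos (τ * ((2 * Real.pi) ^ 3 * (3 * ξ * (ξ - 2 * η) ^ 2))) := by
  have hsq : (ξ - 2 * η) ^ 2 ≤ (4 * δ) ^ 2 := sq_abs (ξ - 2 * η) ▸ by gcongr
  rw [abs_le] at hξ
  have hξ0 : 0 ≤ ξ := by linarith
  have hτ0 := hτ.1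
  set θ := τ * ((2 * Real.pi) ^ 3 * (3 * ξ * (ξ - 2 * η) ^ 2)) with hθ
  have hθ0 : 0 ≤ θ := by positivity
  have hθ1 : θ ≤ 1 := by
    calc θ ≤ T * ((2 * Real.pi) ^ 3 * (3 * (3 * N) * (4 * δ) ^ 2)) := by
          rw [hθ]
          gcongr
          · exact hτ0.trans hτ.2
          · exact hτ.2
          · linarith
      _ = 144 * (2 * Real.pi) ^ 3 * T * (N * δ ^ 2) := by ring
      _ ≤ 1 := hphase
  nlinarith [Real.one_sub_sq_div_two_le_cos (x := θ)]

end Peaks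

section LowerBound

variable {N δ T ξ : ℝ}

theorem I_mul_propagator_mul_source_freeWave (g : ℝ → ℂ) (τ ξ : ℝ) :
    Complex.I * propagator 1 0 (-T) ξ * (propagator 1 0 (T - τ) ξ
        * ((1 / 2 : ℝ) • source (freeWave 4 0 g τ) (freeWave 4 0 g τ) ξ))
      = ((Real.pi * ξ : ℝ) : ℂ) * ∫ η, propagator 1 0 (-τ) ξ
          * (freeWave 4 0 g τ η * freeWave 4 0 g τ (ξ - η)) := by
  have hprop : propagator 1 0 (-τ) ξ = propagator 1 0 (-T) ξ * propagator 1 0 (T - τ) ξ := by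
    rw [← propagator_add]
    ring_nf
  rw [integral_const_mul, hprop, source, convolution_def]
  simp only [ContinuousLinearMap.mul_apply', Complex.real_smul]
  push_cast
  linear_combination (-(Real.pi * ξ * (propagator 1 0 (-T) ξ * propagator 1 0 (T - τ) ξ)
    * ∫ η, freeWave 4 0 g τ η * freeWave 4 0 g τ (ξ - η)) : ℂ) * Complex.I_sq

theorem half_mul_le_re_integral_freeWave (hN : 1 ≤ N) (hδ : 0 < δ) (hδ' : δ ≤ 1 / 4)
    (hphase : 144 * (2 * Real.pi) ^ 3 * T * (N * δ ^ 2) ≤ 1) (hξ : |ξ - 2 * N| ≤ δ)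
    {τ : ℝ} (hτ : τ ∈ Icc 0 T) :
    1 / 2 * δ ≤ (∫ η, propagator 1 0 (-τ) ξ * (freeWave 4 0 (fun ξ => peaks N δ ξ) τ η
      * freeWave 4 0 (fun ξ => peaks N δ ξ) τ (ξ - η))).re := by
  have hdecay := (peaks_mem_fourierData N hδ).1.freeWave 4 0 τ
  have hint : Integrable fun η => propagator 1 0 (-τ) ξ
      * (freeWave 4 0 (fun ξ => peaks N δ ξ) τ η
        * freeWave 4 0 (fun ξ => peaks N δ ξ) τ (ξ - η)) :=
    (hdecay.convolutionExists hdecay ξ).const_mul _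
  have hpoint : ∀ η, 1 / 2 * (peaks N δ η * peaks N δ (ξ - η))
      ≤ (propagator 1 0 (-τ) ξ * (freeWave 4 0 (fun ξ => peaks N δ ξ) τ η
        * freeWave 4 0 (fun ξ => peaks N δ ξ) τ (ξ - η))).re := fun η => by
    rw [propagator_mul_freeWave_mul_freeWave, Complex.re_ofReal_mul,
      Complex.exp_ofReal_mul_I_re, mul_comm]
    rcases eq_or_ne (peaks N δ η * peaks N δ (ξ - η)) 0 with hzero | hne
    · simp [hzero]
    · exact mul_le_mul_of_nonneg_left
        (half_le_cos hN hδ' hphase hτ hξ (abs_sub_two_mul_lt hN hδ hδ' hξ hne))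
        (mul_nonneg (peaks_nonneg _ _ _) (peaks_nonneg _ _ _))
  calc 1 / 2 * δ ≤ 1 / 2 * ∫ η, peaks N δ η * peaks N δ (ξ - η) := by
        gcongr
        exact le_integral_peaks_mul hδ (by linarith) hξ
    _ = ∫ η, 1 / 2 * (peaks N δ η * peaks N δ (ξ - η)) := (integral_const_mul _ _).symm
    _ ≤ _ := integral_mono ((integrable_peaks_mul N hδ ξ).const_mul _) hint.re hpoint
    _ = _ := Complex.reCLM.integral_comp_comm hint

theorem le_norm_secondIterate_peaks (hT : 0 ≤ T) (hN : 1 ≤ N) (hδ : 0 < δ) (hδ' : δ ≤ 1 / 4)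
    (hphase : 144 * (2 * Real.pi) ^ 3 * T * (N * δ ^ 2) ≤ 1) (hξ : |ξ - 2 * N| ≤ δ) :
    T * (N * δ) ≤ ‖secondIterate 4 0 (fun ξ => peaks N δ ξ) T ξ‖ := by
  have hsource : Continuous (Function.uncurry ((1 / 2 : ℝ) • fun τ =>
      source (freeWave 4 0 (fun ξ => peaks N δ ξ) τ) (freeWave 4 0 (fun ξ => peaks N δ ξ) τ))) :=
    (continuous_source_freeWave 4 0 (peaks_mem_fourierData N hδ).1).const_smul (1 / 2 : ℝ)
  refine mul_le_norm_integral (z := Complex.I * propagator 1 0 (-T) ξ) hT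
    (by simp [norm_propagator]) (((continuous_duhamel_integrand 1 0 hsource).comp
      (Continuous.prodMk_right (T, ξ))).intervalIntegrable 0 T) fun τ hτ => ?_
  have hhalf := half_mul_le_re_integral_freeWave hN hδ hδ' hphase hξ hτ
  simp only [Pi.smul_apply]
  rw [I_mul_propagator_mul_source_freeWave, Complex.re_ofReal_mul]
  have hNξ : 2 * N ≤ Real.pi * ξ := by nlinarith [Real.pi_gt_three, (abs_le.mp hξ).1]
  calc N * δ = 2 * N * (1 / 2 * δ) := by ring
    _ ≤ _ := mul_le_mul hNξ hhalf (by positivity) (by linarith)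

end LowerBound

section SobolevNorms

variable {𝔽 : Subalgebra ℝ ℂ} {σ : ℝ} {g : fourierData} {S : Set ℝ} {D : ℝ}

theorem integrable_rpow_mul_norm_sq (g : fourierData) (σ : ℝ) :
    Integrable fun ξ => (1 + ξ ^ 2) ^ σ * ‖g ξ‖ ^ 2 := by
  simpa only [norm_weighted_sq] using (g.2.1.memLp_weighted σ).integrable_norm_pow two_ne_zero

theorem norm_ofFourier_sq_le (hS : MeasurableSet S) (hfin : volume S ≠ ⊤)
    (hsupp : ∀ ξ ∉ S, g ξ = 0) (hD : ∀ ξ ∈ S, (1 + ξ ^ 2) ^ σ * ‖g ξ‖ ^ 2 ≤ D) :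
    ‖ofFourier 𝔽 σ g‖ ^ 2 ≤ volume.real S * D := by
  rw [norm_ofFourier_sq, ← setIntegral_eq_integral_of_forall_compl_eq_zero (s := S)
    fun ξ hξ => by simp [hsupp ξ hξ], ← smul_eq_mul, ← setIntegral_const]
  exact setIntegral_mono_on (integrable_rpow_mul_norm_sq g σ).integrableOn
    (integrableOn_const hfin) hS hD

theorem le_norm_ofFourier_sq (hS : MeasurableSet S) (hfin : volume S ≠ ⊤)
    (hD : ∀ ξ ∈ S, D ≤ (1 + ξ ^ 2) ^ σ * ‖g ξ‖ ^ 2) :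
    volume.real S * D ≤ ‖ofFourier 𝔽 σ g‖ ^ 2 := by
  rw [norm_ofFourier_sq, ← smul_eq_mul, ← setIntegral_const]
  exact (setIntegral_mono_on (integrableOn_const hfin)
    (integrable_rpow_mul_norm_sq g σ).integrableOn hS hD).trans
    (setIntegral_le_integral (integrable_rpow_mul_norm_sq g σ)
      (Eventually.of_forall fun ξ => by positivity))

theorem rpow_mem_Icc {K y : ℝ} (hK : 0 < K) (hy : y ∈ Icc K⁻¹ K) (s : ℝ) :
    y ^ s ∈ Icc (K ^ |s|)⁻¹ (K ^ |s|) := by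
  have hy0 : 0 < y := (inv_pos.mpr hK).trans_le hy.1
  have hlog : |Real.log y| ≤ Real.log K := by
    rw [abs_le, ← Real.log_inv]
    exact ⟨Real.log_le_log (inv_pos.mpr hK) hy.1, Real.log_le_log hy0 hy.2⟩
  have habs : |Real.log y * s| ≤ Real.log K * |s| := by
    rw [abs_mul]
    gcongr
  rw [Real.rpow_def_of_pos hy0, Real.rpow_def_of_pos hK, ← Real.exp_neg]
  exact ⟨Real.exp_le_exp.mpr (abs_le.mp habs).1, Real.exp_le_exp.mpr (abs_le.mp habs).2⟩

theorem one_add_sq_rpow_mem_Icc {N ξ : ℝ} (s : ℝ) (hN : 1 ≤ N) (hξ : N / 2 ≤ |ξ|)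
    (hξ' : |ξ| ≤ 3 * N) :
    (1 + ξ ^ 2) ^ s ∈ Icc (((10 : ℝ) ^ |s|)⁻¹ * N ^ (2 * s)) ((10 : ℝ) ^ |s| * N ^ (2 * s)) := by
  have hN0 : 0 < N := by linarith
  have hquot : (1 + ξ ^ 2) / N ^ 2 ∈ Icc (10 : ℝ)⁻¹ 10 := by
    rw [← sq_abs, mem_Icc, le_div_iff₀ (by positivity), div_le_iff₀ (by positivity)]
    constructor <;> nlinarith
  have hsplit : (1 + ξ ^ 2) ^ s = ((1 + ξ ^ 2) / N ^ 2) ^ s * N ^ (2 * s) := by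
    rw [Real.rpow_mul hN0.le, Real.rpow_two, ← Real.mul_rpow (by positivity) (by positivity),
      div_mul_cancel₀ _ (by positivity)]
  obtain ⟨hlower, hupper⟩ := rpow_mem_Icc (by norm_num) hquot s
  rw [hsplit]
  exact ⟨by gcongr, by gcongr⟩

end SobolevNorms

section Growth

open scoped NNReal

variable {𝔽 : Subalgebra ℝ ℂ} {s N δ : ℝ}

theorem norm_ofFourier_sq_le_of_peaks {g : fourierData} (hN : 1 ≤ N) (hδ : 0 < δ) (hδ' : δ ≤ 1 / 4)
    (hg : (g : ℝ → ℂ) = fun ξ => (peaks N δ ξ : ℂ)) :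
    ‖ofFourier 𝔽 s g‖ ^ 2 ≤ 8 * δ * ((10 : ℝ) ^ |s| * N ^ (2 * s)) := by
  let S := Icc (N - 2 * δ) (N + 2 * δ) ∪ Icc (-N - 2 * δ) (-N + 2 * δ)
  have hmem : ∀ ξ, peaks N δ ξ ≠ 0 → ξ ∈ S := fun ξ hξ => by
    have habs := abs_lt.mp (abs_lt_of_peaks_ne_zero hδ hξ)
    rcases abs_choice ξ with h | h
    · exact Or.inl ⟨by linarith, by linarith⟩
    · exact Or.inr ⟨by linarith, by linarith⟩
  have hvol : volume.real S ≤ 8 * δ := by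
    refine (measureReal_union_le _ _).trans ?_
    rw [Real.volume_real_Icc_of_le (by linarith), Real.volume_real_Icc_of_le (by linarith)]
    linarith
  have hbound : ∀ ξ, (1 + ξ ^ 2) ^ s * ‖g ξ‖ ^ 2 ≤ (10 : ℝ) ^ |s| * N ^ (2 * s) := fun ξ => by
    rw [congrFun hg ξ, Complex.norm_real, Real.norm_of_nonneg (peaks_nonneg _ _ _)]
    rcases eq_or_ne (peaks N δ ξ) 0 with hzero | hne
    · rw [hzero, zero_pow two_ne_zero, mul_zero]
      positivity
    · have habs := abs_lt.mp (abs_lt_of_peaks_ne_zero hδ hne)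
      exact (mul_le_of_le_one_right (by positivity)
        (pow_le_one₀ (peaks_nonneg _ _ _) (peaks_le_one _ _ _))).trans
        (one_add_sq_rpow_mem_Icc s hN (by linarith) (by linarith)).2
  have hsupp : ∀ ξ ∉ S, g ξ = 0 := fun ξ hξ => by
    rw [congrFun hg ξ, not_imp_comm.mp (hmem ξ) hξ, Complex.ofReal_zero]
  exact (norm_ofFourier_sq_le (measurableSet_Icc.union measurableSet_Icc)
    (isCompact_Icc.union isCompact_Icc).measure_ne_top hsupp fun ξ _ => hbound ξ).trans
    (mul_le_mul_of_nonneg_right hvol (by positivity))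

theorem le_norm_ofFourier_sq_of_secondIterate {q : fourierData} {T : ℝ} (hT : 0 ≤ T) (hN : 1 ≤ N)
    (hδ : 0 < δ) (hδ' : δ ≤ 1 / 4) (hphase : 144 * (2 * Real.pi) ^ 3 * T * (N * δ ^ 2) ≤ 1)
    (hq : (q : ℝ → ℂ) = secondIterate 4 0 (fun ξ => peaks N δ ξ) T) :
    2 * δ * (((10 : ℝ) ^ |s|)⁻¹ * N ^ (2 * s) * (T * (N * δ)) ^ 2) ≤ ‖ofFourier 𝔽 s q‖ ^ 2 := by
  have hvol : volume.real (Icc (2 * N - δ) (2 * N + δ)) = 2 * δ := by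
    rw [Real.volume_real_Icc_of_le (by linarith)]
    ring
  rw [← hvol]
  refine le_norm_ofFourier_sq measurableSet_Icc isCompact_Icc.measure_ne_top fun ξ hξ => ?_
  have hdist : |ξ - 2 * N| ≤ δ := abs_le.mpr ⟨by linarith [hξ.1], by linarith [hξ.2]⟩
  have habs : |ξ| = ξ := abs_of_nonneg (by linarith [hξ.1])
  rw [congrFun hq ξ]
  gcongr
  · exact (one_add_sq_rpow_mem_Icc s hN (by linarith [hξ.1]) (by linarith [hξ.2])).1
  · exact le_norm_secondIterate_peaks hT hN hδ hδ' hphase hdist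

theorem exists_scales (hs : s < 3 / 4) {A : ℝ} (hA : 0 ≤ A) (D : ℝ) :
    ∃ N δ : ℝ, 1 ≤ N ∧ 0 < δ ∧ δ ≤ 1 / 4 ∧ A * (N * δ ^ 2) ≤ 1 ∧ D * N ^ (2 * s) < N ^ 2 * δ := by
  let κ : ℝ := 1 / (4 + A)
  have hκ : 0 < κ := by positivity
  have hκA : (4 + A) * κ = 1 := mul_one_div_cancel (by positivity)
  obtain ⟨N, hN, hlarge⟩ := ((eventually_ge_atTop 1).and
    ((tendsto_rpow_atTop (by linarith : 0 < 3 / 2 - 2 * s)).eventually_gt_atTop (D / κ))).exists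
  have hN0 : 0 < N := by linarith
  have hsq : (N ^ (-(1 / 2) : ℝ)) ^ 2 = N⁻¹ := by
    rw [← Real.rpow_mul_natCast hN0.le, ← Real.rpow_neg_one]
    norm_num
  refine ⟨N, κ * N ^ (-(1 / 2) : ℝ), hN, by positivity, ?_, ?_, ?_⟩
  · exact (mul_le_of_le_one_right hκ.le
      (Real.rpow_le_one_of_one_le_of_nonpos hN (by norm_num))).trans (by nlinarith)
  · calc A * (N * (κ * N ^ (-(1 / 2) : ℝ)) ^ 2) = A * κ * κ := by
          rw [mul_pow, hsq]
          field_simp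
      _ ≤ 1 := by nlinarith [mul_nonneg hA hκ.le]
  · have hpow : N ^ 2 * N ^ (-(1 / 2) : ℝ) = N ^ (3 / 2 - 2 * s) * N ^ (2 * s) := by
      rw [← Real.rpow_two, ← Real.rpow_add hN0, ← Real.rpow_add hN0]
      ring_nf
    rw [mul_left_comm, hpow, ← mul_assoc]
    exact mul_lt_mul_of_pos_right ((div_lt_iff₀' hκ).mp hlarge) (by positivity)

theorem exists_lt_norm_ofFourier_secondIterate (hs : s < 3 / 4) {T : ℝ≥0} (hT : 0 < T) (C : ℝ) :
    ∃ g q : fourierData, HasCompactSupport g ∧ (q : ℝ → ℂ) = secondIterate 4 0 g T ∧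
      C * ‖ofFourier 𝔽 s g‖ ^ 2 < ‖ofFourier 𝔽 s q‖ := by
  let K : ℝ := 10 ^ |s|
  have hK : 0 < K := by positivity
  have hT' : (0 : ℝ) < T := hT
  obtain ⟨N, δ, hN, hδ, hδ', hphase, hlarge⟩ := exists_scales hs
    (A := 144 * (2 * Real.pi) ^ 3 * T) (by positivity) (32 * C ^ 2 * K ^ 3 / T ^ 2)
  let g : fourierData := ⟨_, peaks_mem_fourierData N hδ⟩
  have hsupp : HasCompactSupport g := hasCompactSupport_ofReal_peaks N hδ
  let q : fourierData := ⟨_, secondIterate_mem_fourierData 4 0 g hsupp T⟩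
  refine ⟨g, q, hsupp, rfl, lt_of_pow_lt_pow_left₀ 2 (norm_nonneg _) ?_⟩
  have hg := norm_ofFourier_sq_le_of_peaks (𝔽 := 𝔽) (s := s) (g := g) hN hδ hδ' rfl
  have hq := le_norm_ofFourier_sq_of_secondIterate (𝔽 := 𝔽) (s := s) (q := q) hT'.le hN hδ hδ'
    hphase rfl
  rw [div_mul_eq_mul_div, div_lt_iff₀ (by positivity)] at hlarge
  calc (C * ‖ofFourier 𝔽 s g‖ ^ 2) ^ 2 ≤ C ^ 2 * (8 * δ * (K * N ^ (2 * s))) ^ 2 := by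
        rw [mul_pow]
        gcongr
    _ = 2 * δ ^ 2 * K⁻¹ * N ^ (2 * s) * (32 * C ^ 2 * K ^ 3 * N ^ (2 * s)) := by
        field_simp
        ring
    _ < 2 * δ ^ 2 * K⁻¹ * N ^ (2 * s) * (N ^ 2 * δ * T ^ 2) := by gcongr
    _ = 2 * δ * (K⁻¹ * N ^ (2 * s) * (T * (N * δ)) ^ 2) := by ring
    _ ≤ ‖ofFourier 𝔽 s q‖ ^ 2 := hq

end Growth

end MajdaBiello

end

theorem propositionA1 (𝔽 : Subalgebra ℝ ℂ) (s : ℝ) (hs : s < 3 / 4) :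
    ¬ MajdaBiello.IsLocallyWellPosed 2 𝔽 4 0 s := by
  intro hwp
  obtain ⟨T, C, hT, hbound⟩ := hwp.exists_norm_ofFourier_secondIterate_le
  obtain ⟨g, q, hsupp, hq, hgrowth⟩ :=
    MajdaBiello.exists_lt_norm_ofFourier_secondIterate (𝔽 := 𝔽) hs hT C
  exact (hbound g q hsupp hq).not_gt hgrowth
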